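/- Let $d,r,N\ge 1$ be integers, $1<p,q<\infty$, $K_1,K_2>0$ and $C_K=[-K_1,K_1]\times[-K_2,K_2]^d\subset\mathbb R\times\mathbb R^d$. On $\mathbb R^d$ let $|\cdot|$ be the Euclidean norm, and for $k\in\mathbb Z^d$ let $|k|=\max_i|k_i|$. Write $$\|f\|_{L^{p,q}(A\times B)}=\Big(\int_A\Big(\int_B|f(x,y)|^q\,dy\Big)^{p/q}dx\Big)^{1/p},\qquad \|c\|_{l^{p,q}}=\Big(\sum_{k_1\in\mathbb Z}\Big(\sum_{k_2\in\mathbb Z^d}|c(k_1,k_2)|^q\Big)^{p/q}\Big)^{1/p},$$ and $\|\mathbf c\|_{l^{p,q}}=\sum_{i=1}^r\|c_i\|_{l^{p,q}}$ for $\mathbf c=(c_1,\dots,c_r)$. Assume the following. (A1) $\Phi=(\phi_1,\dots,\phi_r)^T$ consists of continuous functions $\phi_i\in L^{p,q}(\mathbb R\times\mathbb R^d)$ with values in $\mathbb C$; there are $\alpha_1,\alpha_2>0$ with $$\alpha_1\|\mathbf c\|_{l^{p,q}}\le\Big\|\sum_{k_1\in\mathbb Z}\sum_{k_2\in\mathbb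 Z^d}\mathbf c^T(k_1,k_2)\Phi(\cdot-k_1,\cdot-k_2)\Big\|_{L^{p,q}(\mathbb R\times\mathbb R^d)}\le\alpha_2\|\mathbf c\|_{l^{p,q}}\quad\text{for all }\mathbf c\in(l^{p,q}(\mathbb Z\times\mathbb Z^d))^r;$$ and there are $\tilde c>0$ and positive $s_1,s_2>d+1-\frac1p-\frac dq$ with $|\phi_i(x,y)|\le\tilde c\,(1+|x|)^{-s_1}(1+|y|)^{-s_2}$ for all $i$ and $(x,y)$. (A2) $\psi\in L^1(\mathbb R^{d+1})$ is complex valued with $\operatorname{supp}\psi\subseteq C_K$; put $\|\psi\|=\|\psi\|_{L^{1,1}(C_K)}=\int_{C_K}|\psi|$. (A3) $\rho$ is a probability density on $C_K$ with $\mathcal C_{\rho,1}\le\rho\le\mathcal C_{\rho,2}$ on $C_K$, where $\mathcal C_{\rho,1},\mathcal C_{\rho,2}>0$. Let $(x_j,y_k)$, $j,k\in\mathbb N$, denote a doubly indexed family of independent, identically distributed random points of $C_K$ with density $\rho$ (one independent point for each pair of indices $(j,k)$). Suppose that for some $\tilde\beta>0$ $$\Big\|\sum_{|k_1|\le N}\sum_{|k_2|\le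 N}\mathbf c^T(k_1,k_2)(\Phi*\psi)(\cdot-k_1,\cdot-k_2)\Big\|_{L^{p,q}(C_K)}\ge\tilde\beta\,\|\mathbf c\|_{l^{p,q}}$$ for all $\mathbf c=(c_1,\dots,c_r)$ supported in $\{|k_1|\le N,\ |k_2|\le N\}$. Let $V_N^{p,q}(\Phi)$ be the space of all sums $\sum_{i=1}^r\sum_{|k_1|\le N}\sum_{|k_2|\le N}c_i(k_1,k_2)\,\phi_i(\cdot-k_1,\cdot-k_2)$ with complex coefficients. Then for every $\gamma\in(0,1)$ and all $n,m\in\mathbb N$ there are functions $G_{j,k}:\mathbb R\times\mathbb R^d\to\mathbb C$, $1\le j\le n$, $1\le k\le m$ (depending on the sample points, but not on $f$), such that with probability at least $$1-\mathcal A_1\exp\!\left(-nm\,\frac{(2K_1)^{1-q}(2K_2)^{d(1-p)}\big(\tfrac{\sqrt3}{2}\tau\big)^2}{6(2K_1)^{q-1}(2K_2)^{d(p-1)}+\tau}\right)-\mathcal A_2\exp\!\left(-nm\,\frac{(2K_1)^{1-q}(2K_2)^{d(1-p)}(\tau c^*)^2}{18\sqrt2\,\big(81(2K_1)^{q-1}(2K_2)^{d(p-1)}+2\tau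 c^*\big)}\right)$$ the identity $$f(x,y)=\sum_{j=1}^n\sum_{k=1}^m(f*\psi)(x_j,y_k)\,G_{j,k}(x,y),\qquad(x,y)\in\mathbb R\times\mathbb R^d,$$ holds simultaneously for all $f\in V_N^{p,q}(\Phi)$. Here $$\tau=\gamma\,\mathcal C_{\rho,1}\left(\frac{\tilde\beta(\alpha_2c^*)^{-1}}{\|\psi\|}\right)^{pq},\quad \mathcal A_1=2\exp\!\big(r(2N+1)^{d+1}\ln(4c^*+1)\big),\quad \mathcal A_2=\frac{4\big((2c^*+\frac14)(c^*+\frac14)\big)^{r(2N+1)^{d+1}}}{3r(\ln2)^2(2N+1)^{d+1}},$$ $$c^*=\frac{4\tilde c}{2^{\frac{p+q}{pq}}\alpha_1}\Big(\sum_{k_1\in\mathbb Z}(1+|k_1|)^{-\frac{s_1p}{p-1}}\Big)^{\frac{p-1}p}\Big(\sum_{k_2\in\mathbb Z^d}(1+|k_2|)^{-\frac{s_2q}{q-1}}\Big)^{\frac{q-1}q}.$$ -/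

import Mathlib

open MeasureTheory ProbabilityTheory
open scoped ENNReal

noncomputable section

namespace MixedSampling

/-- `ℝ × ℝ^d`, where `ℝ^d` carries the Euclidean norm and Lebesgue measure. -/
abbrev Dom (d : ℕ) : Type := ℝ × EuclideanSpace ℝ (Fin d)

/-- The index set `ℤ × ℤ^d`. The norm `‖k.2‖` of `k.2 : Fin d → ℤ` is `max |k.2 i|`. -/
abbrev Idx (d : ℕ) : Type := ℤ × (Fin d → ℤ)

/-- The point of `ℝ × ℝ^d` with the integer coordinates `k`. -/
def latticePt {d : ℕ} (k : Idx d) : Dom d :=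
  ((k.1 : ℝ), WithLp.toLp 2 (fun i => (k.2 i : ℝ)))

/-- The cube `[-K₂, K₂]^d`. -/
def cube (d : ℕ) (K₂ : ℝ) : Set (EuclideanSpace ℝ (Fin d)) :=
  {y | ∀ i, y i ∈ Set.Icc (-K₂) K₂}

/-- The cuboid `C_K = [-K₁, K₁] × [-K₂, K₂]^d`. -/
def cuboid (d : ℕ) (K₁ K₂ : ℝ) : Set (Dom d) :=
  Set.Icc (-K₁) K₁ ×ˢ cube d K₂

/-- The mixed Lebesgue norm `‖f‖_{L^{p,q}(A × B)}`, with values in `[0, ∞]`. -/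
def mixedNormOn {d : ℕ} (p q : ℝ) (A : Set ℝ) (B : Set (EuclideanSpace ℝ (Fin d)))
    (f : Dom d → ℂ) : ℝ≥0∞ :=
  (∫⁻ x in A, (∫⁻ y in B, ‖f (x, y)‖ₑ ^ q) ^ (p / q)) ^ (1 / p)

/-- `‖f‖_{L^{p,q}(ℝ × ℝ^d)}`. -/
def mixedNorm {d : ℕ} (p q : ℝ) (f : Dom d → ℂ) : ℝ≥0∞ :=
  mixedNormOn p q Set.univ Set.univ f

/-- `‖f‖_{L^{p,q}(C_K)}`. -/
def mixedNormCuboid {d : ℕ} (p q K₁ K₂ : ℝ) (f : Dom d → ℂ) : ℝ≥0∞ :=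
  mixedNormOn p q (Set.Icc (-K₁) K₁) (cube d K₂) f

/-- Membership in `L^{p,q}(ℝ × ℝ^d)`. -/
def MemMixed {d : ℕ} (p q : ℝ) (f : Dom d → ℂ) : Prop :=
  AEStronglyMeasurable f volume ∧ mixedNorm p q f < ∞

/-- `‖c‖_{l^{p,q}(ℤ × ℤ^d)}` of a scalar sequence, with values in `[0, ∞]`. -/
def seqNorm {d : ℕ} (p q : ℝ) (c : Idx d → ℂ) : ℝ≥0∞ :=
  (∑' k₁ : ℤ, (∑' k₂ : Fin d → ℤ, ‖c (k₁, k₂)‖ₑ ^ q) ^ (p / q)) ^ (1 / p)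

/-- The norm `∑ i, ‖c_i‖_{l^{p,q}}` of an `r`-tuple of sequences. -/
def vecSeqNorm {d r : ℕ} (p q : ℝ) (c : Fin r → Idx d → ℂ) : ℝ≥0∞ :=
  ∑ i, seqNorm p q (c i)

/-- The series `∑_k c(k)ᵀ Φ(· - k)` over `ℤ × ℤ^d`, summed pointwise. -/
def synth {d r : ℕ} (φ : Fin r → Dom d → ℂ) (c : Fin r → Idx d → ℂ) (z : Dom d) : ℂ :=
  ∑' k : Idx d, ∑ i, c i k * φ i (z - latticePt k)

/-- The indices `k = (k₁, k₂)` with `|k₁| ≤ N` and `max |k₂ i| ≤ N`. -/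
def box (d N : ℕ) : Finset (Idx d) :=
  Finset.Icc (-(N : ℤ)) N ×ˢ Fintype.piFinset (fun _ => Finset.Icc (-(N : ℤ)) N)

/-- The finite sum `∑_{|k₁| ≤ N} ∑_{|k₂| ≤ N} c(k)ᵀ Φ(· - k)`. -/
def finSynth {d r : ℕ} (N : ℕ) (φ : Fin r → Dom d → ℂ) (c : Fin r → Idx d → ℂ)
    (z : Dom d) : ℂ :=
  ∑ k ∈ box d N, ∑ i, c i k * φ i (z - latticePt k)

/-- The finite dimensional space `V_N^{p,q}(Φ)`. -/
def VN {d r : ℕ} (N : ℕ) (φ : Fin r → Dom d → ℂ) : Set (Dom d → ℂ) :=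
  {f | ∃ c : Fin r → Idx d → ℂ, f = finSynth N φ c}

/-- The convolution `f * ψ` on `ℝ × ℝ^d`. -/
def conv {d : ℕ} (f ψ : Dom d → ℂ) : Dom d → ℂ :=
  MeasureTheory.convolution f ψ (ContinuousLinearMap.mul ℝ ℂ) volume

/-- The assumption on the generators `Φ = (φ_1, …, φ_r)`, with its constants: they lie in
`L^{p,q}`, have stable shifts, are continuous and decay polynomially. The decay makes the series
`synth φ c` converge absolutely at every point for `c` in `(l^{p,q})^r`. -/
structure GeneratorAssumption {d r : ℕ} (p q : ℝ) (φ : Fin r → Dom d → ℂ)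
    (α₁ α₂ ctil s₁ s₂ : ℝ) : Prop where
  mem : ∀ i, MemMixed p q (φ i)
  α₁_pos : 0 < α₁
  α₂_pos : 0 < α₂
  stable : ∀ c : Fin r → Idx d → ℂ, (∀ i, seqNorm p q (c i) < ∞) →
    ENNReal.ofReal α₁ * vecSeqNorm p q c ≤ mixedNorm p q (synth φ c) ∧
      mixedNorm p q (synth φ c) ≤ ENNReal.ofReal α₂ * vecSeqNorm p q c
  continuous : ∀ i, Continuous (φ i)
  ctil_pos : 0 < ctil
  s₁_pos : 0 < s₁
  s₂_pos : 0 < s₂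
  s₁_gt : (d : ℝ) + 1 - 1 / p - d / q < s₁
  s₂_gt : (d : ℝ) + 1 - 1 / p - d / q < s₂
  decay : ∀ i, ∀ z : Dom d,
    ‖φ i z‖ ≤ ctil / ((1 + |z.1|) ^ s₁ * (1 + ‖z.2‖) ^ s₂)

/-- The averaging function `ψ ∈ L¹(ℝ^{d+1})` is supported in `C_K` (as an `L¹` function, that is,
it vanishes almost everywhere outside `C_K`). -/
structure AveragingAssumption {d : ℕ} (K₁ K₂ : ℝ) (ψ : Dom d → ℂ) : Prop where
  integrable : Integrable ψ volume
  supp : ∀ᵐ z ∂(volume : Measure (Dom d)), z ∉ cuboid d K₁ K₂ → ψ z = 0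

/-- `ρ` is a probability density over `C_K` with `Cρ₁ ≤ ρ ≤ Cρ₂` there. -/
structure DensityAssumption {d : ℕ} (K₁ K₂ : ℝ) (ρ : Dom d → ℝ) (Cρ₁ Cρ₂ : ℝ) : Prop where
  integrable : IntegrableOn ρ (cuboid d K₁ K₂) volume
  integral_eq_one : ∫ z in cuboid d K₁ K₂, ρ z = 1
  lower_pos : 0 < Cρ₁
  upper_pos : 0 < Cρ₂
  bounds : ∀ z ∈ cuboid d K₁ K₂, Cρ₁ ≤ ρ z ∧ ρ z ≤ Cρ₂

/-- The samples `(x_j, y_k)`, `j, k ∈ ℕ`, are independent random points, each of them with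
density `ρ` on `C_K`. -/
structure IIDSamples {Ω : Type*} [MeasurableSpace Ω] (P : Measure Ω) {d : ℕ} (K₁ K₂ : ℝ)
    (ρ : Dom d → ℝ) (X : ℕ → ℕ → Ω → Dom d) : Prop where
  measurable : ∀ j k, Measurable (X j k)
  indep : iIndepFun (fun jk : ℕ × ℕ => X jk.1 jk.2) P
  law : ∀ j k, P.map (X j k) =
    (volume.restrict (cuboid d K₁ K₂)).withDensity (fun z => ENNReal.ofReal (ρ z))

/-- `‖ψ‖_{L^{1,1}(C_K)}`. -/
def l1Norm {d : ℕ} (K₁ K₂ : ℝ) (ψ : Dom d → ℂ) : ℝ :=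
  ∫ z in cuboid d K₁ K₂, ‖ψ z‖

/-- The constant `c^*`. -/
def cStar (d : ℕ) (p q α₁ ctil s₁ s₂ : ℝ) : ℝ :=
  4 * ctil / ((2 : ℝ) ^ ((p + q) / (p * q)) * α₁)
    * (∑' k₁ : ℤ, 1 / (1 + |(k₁ : ℝ)|) ^ (s₁ * p / (p - 1))) ^ ((p - 1) / p)
    * (∑' k₂ : Fin d → ℤ, 1 / (1 + ‖k₂‖) ^ (s₂ * q / (q - 1))) ^ ((q - 1) / q)

/-- The constant `𝒜₁`, in terms of `c = c^*`. -/
def constA₁ (d r N : ℕ) (c : ℝ) : ℝ :=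
  2 * Real.exp ((r : ℝ) * (2 * (N : ℝ) + 1) ^ (d + 1) * Real.log (4 * c + 1))

/-- The constant `𝒜₂`, in terms of `c = c^*`. -/
def constA₂ (d r N : ℕ) (c : ℝ) : ℝ :=
  4 * ((2 * c + 1 / 4) * (c + 1 / 4)) ^ (r * (2 * N + 1) ^ (d + 1))
    / (3 * (r : ℝ) * (Real.log 2) ^ 2 * (2 * (N : ℝ) + 1) ^ (d + 1))

/-- The quantity `γ C_{ρ,1} (β (α₂ c)⁻¹ / Ψ)^{pq}`, where `Ψ = ‖ψ‖_{L^{1,1}(C_K)}`. -/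
def tau (p q γ Cρ₁ β α₂ c Ψ : ℝ) : ℝ :=
  γ * Cρ₁ * (β * (α₂ * c)⁻¹ / Ψ) ^ (p * q)

/-- The first exponential rate, in terms of `τ`. -/
def rate₁ (d : ℕ) (p q K₁ K₂ τ : ℝ) : ℝ :=
  (2 * K₁) ^ (1 - q) * (2 * K₂) ^ ((d : ℝ) * (1 - p)) * (Real.sqrt 3 / 2 * τ) ^ 2
    / (6 * (2 * K₁) ^ (q - 1) * (2 * K₂) ^ ((d : ℝ) * (p - 1)) + τ)

/-- The second exponential rate, in terms of `τ` and `c = c^*`. -/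
def rate₂ (d : ℕ) (p q K₁ K₂ τ c : ℝ) : ℝ :=
  (2 * K₁) ^ (1 - q) * (2 * K₂) ^ ((d : ℝ) * (1 - p)) * (τ * c) ^ 2
    / (18 * Real.sqrt 2
        * (81 * (2 * K₁) ^ (q - 1) * (2 * K₂) ^ ((d : ℝ) * (p - 1)) + 2 * τ * c))

/-- The probability bound `1 - 𝒜₁ exp(-nm rate₁) - 𝒜₂ exp(-nm rate₂)`. -/
def probBound (d r N n m : ℕ) (p q K₁ K₂ γ Cρ₁ β α₂ c Ψ : ℝ) : ℝ :=
  1 - constA₁ d r N c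
        * Real.exp (-((n : ℝ) * m * rate₁ d p q K₁ K₂ (tau p q γ Cρ₁ β α₂ c Ψ)))
    - constA₂ d r N c
        * Real.exp (-((n : ℝ) * m * rate₂ d p q K₁ K₂ (tau p q γ Cρ₁ β α₂ c Ψ) c))

end MixedSampling

end

noncomputable section

/-! ### One-variable and product inequalities behind the rounding argument. -/

namespace MixedSampling

/-! Reconstruction on `V_N` is possible as soon as the samples of `f * ψ` determine the finitely
many coefficients of `f`: a left inverse of the sampling map supplies the functions `G`. Only the
probability of a nontrivial kernel has to be bounded, and this is done by watching its dimension as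
the points are drawn one after another.

Two estimates drive the argument. With `M = α₂ c* ‖ψ‖`, the function `f * ψ` is bounded by `M ‖c‖`.
The assumed lower `L^{p,q}` bound, interpolated against this supremum bound, shows that its `L¹`
norm for the sampling law is at least `t M ‖c‖`, where `τ = γ B t` and `B = (2K₁)^{q-1}
(2K₂)^{d(p-1)}`. Hence a subspace of dimension `m` cannot vanish identically outside a set of
probability less than `t √m` (`mul_sqrt_finrank_le_nonvanishing`), so the next sample lowers a
kernel of dimension `m` with at least that probability. The potential `1 + t √m`, set to `0` at `m =
0`, then contracts in mean by `1 - t²/8` per sample (`dropPotential_step`) and starts at most at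
`2`. The failure probability is thus at most `2 exp(-nm t²/8)`, which the first exponential term of
the claim already dominates.

The supremum bound comes from Hölder's inequality once lattice sums over translates, in Euclidean
length, are compared with the sum over the lattice itself in the maximum norm. `tsum_translate_le`
does this with constant 1: the point is rounded at random to an integer point, and the profile is at
most the mean of its rounded values. -/

lemma half_add_pow_mul_le {ρ : ℝ} (h1 : 1 ≤ ρ) (h2 : ρ ≤ 2) (n : ℕ) :
    ((1 + ρ) / 2) ^ n * (2 ^ n - ρ ^ n) ≤ (2 - ρ) * ρ ^ (n + 1) * (2 ^ n - 1) := by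
  induction n with
  | zero => simp
  | succ n ih =>
    set h : ℝ := (1 + ρ) / 2 with hh
    have hh1 : 1 ≤ h := by rw [hh]; linarith
    have hhρ : h ≤ ρ := by rw [hh]; linarith
    -- The difference of the two sides is `(ρ - 1)(2 - ρ)/2`.
    have hρ : 1 ≤ ρ * (2 - h) := by rw [hh]; nlinarith
    have hpow : h ^ (n + 1) ≤ ρ ^ (n + 1) := pow_le_pow_left₀ (by linarith) hhρ _
    have hρpos : 0 < ρ ^ (n + 1) := by positivity
    have key : h ^ (n + 1) ≤ (2 - h) * ρ ^ (n + 2) := by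
      have : (2 - h) * ρ ^ (n + 2) = ρ ^ (n + 1) * (ρ * (2 - h)) := by ring
      rw [this]; nlinarith
    have e1 : h ^ (n + 1) * (2 ^ (n + 1) - ρ ^ (n + 1)) =
        h * ρ * (h ^ n * (2 ^ n - ρ ^ n)) + (2 - ρ) * 2 ^ n * h ^ (n + 1) := by ring
    have e2 : h * ρ * (h ^ n * (2 ^ n - ρ ^ n)) ≤
        h * ρ * ((2 - ρ) * ρ ^ (n + 1) * (2 ^ n - 1)) :=
      mul_le_mul_of_nonneg_left ih (by positivity)
    have e3 : (2 - ρ) * 2 ^ n * h ^ (n + 1) ≤ (2 - ρ) * 2 ^ n * ((2 - h) * ρ ^ (n + 2)) :=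
      mul_le_mul_of_nonneg_left key (mul_nonneg (by linarith) (by positivity))
    have e4 : 0 ≤ (2 - ρ) * (h - 1) * ρ ^ (n + 2) :=
      mul_nonneg (mul_nonneg (by linarith) (by linarith)) (by positivity)
    have e5 : (2 - ρ) * ρ ^ (n + 1 + 1) * (2 ^ (n + 1) - 1) =
        h * ρ * ((2 - ρ) * ρ ^ (n + 1) * (2 ^ n - 1)) +
          (2 - ρ) * 2 ^ n * ((2 - h) * ρ ^ (n + 2)) + (2 - ρ) * (h - 1) * ρ ^ (n + 2) := by ring
    linarith

/-- This is what remains of `inv_one_add_pow_le` once the product has been eliminated. For `n < 4`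
the factor `1/√n` may be replaced by 1 and the difference of the sides factors; for `n ≥ 4` it may
be replaced by `1/2`, which leads to `half_add_pow_mul_le` with `ρ = 1 + r`. -/
lemma one_add_div_sqrt_pow_mul_le {r : ℝ} (h0 : 0 ≤ r) (h1 : r ≤ 1) {n : ℕ} (hn : 0 < n) :
    (1 + r / √n) ^ n * (2 ^ n - (1 + r) ^ n) ≤
      (1 - r) * (1 + r) ^ (n + 1) * (2 ^ n - 1) := by
  have hsn : 1 ≤ √(n : ℝ) := by
    rw [Real.one_le_sqrt]; exact_mod_cast hn
  have hdiff : 0 ≤ (2 : ℝ) ^ n - (1 + r) ^ n :=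
    sub_nonneg.2 (pow_le_pow_left₀ (by linarith) (by linarith) _)
  have hs0 : 0 ≤ 1 + r / √n := by positivity
  have hs : 1 + r / √n ≤ 1 + r := by
    have : r / √n ≤ r := div_le_self h0 hsn
    linarith
  rcases lt_or_ge n 4 with h4 | h4
  · refine (mul_le_mul_of_nonneg_right (pow_le_pow_left₀ hs0 hs n) hdiff).trans ?_
    interval_cases n
    · have : (1 - r) * (1 + r) ^ (1 + 1) * (2 ^ 1 - 1) - (1 + r) ^ 1 * (2 ^ 1 - (1 + r) ^ 1) =
        (1 - r) * (1 + r) * r := by ring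
      have h2 : 0 ≤ (1 - r) * (1 + r) * r :=
        mul_nonneg (mul_nonneg (by linarith) (by positivity)) h0
      linarith
    · have : (1 - r) * (1 + r) ^ (2 + 1) * (2 ^ 2 - 1) - (1 + r) ^ 2 * (2 ^ 2 - (1 + r) ^ 2) =
        2 * ((1 - r) * (1 + r) ^ 2 * r) := by ring
      have h2 : 0 ≤ (1 - r) * (1 + r) ^ 2 * r :=
        mul_nonneg (mul_nonneg (by linarith) (by positivity)) h0
      linarith
    · have : (1 - r) * (1 + r) ^ (3 + 1) * (2 ^ 3 - 1) - (1 + r) ^ 3 * (2 ^ 3 - (1 + r) ^ 3) =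
        (1 - r) * (1 + r) ^ 3 * (r * (3 - r)) := by ring
      have h2 : 0 ≤ (1 - r) * (1 + r) ^ 3 * (r * (3 - r)) :=
        mul_nonneg (mul_nonneg (by linarith) (by positivity)) (mul_nonneg h0 (by linarith))
      linarith
  · have hs2 : 1 + r / √n ≤ (1 + (1 + r)) / 2 := by
      have h2 : (2 : ℝ) ≤ √n := by
        rw [show (2 : ℝ) = √4 by rw [show (4 : ℝ) = 2 ^ 2 by norm_num]; simp]
        exact Real.sqrt_le_sqrt (by exact_mod_cast h4)
      have : r / √n ≤ r / 2 := div_le_div_of_nonneg_left h0 (by norm_num) h2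
      linarith
    refine (mul_le_mul_of_nonneg_right (pow_le_pow_left₀ hs0 hs2 n) hdiff).trans ?_
    have := half_add_pow_mul_le (ρ := 1 + r) (by linarith) (by linarith) n
    rwa [show 2 - (1 + r) = 1 - r by ring] at this

lemma one_sub_sum_le_prod {ι : Type*} (s : Finset ι) (f : ι → ℝ)
    (h0 : ∀ i, 0 ≤ f i) (h1 : ∀ i, f i ≤ 1) :
    1 - ∑ i ∈ s, f i ≤ ∏ i ∈ s, (1 - f i) := by
  classical
  induction s using Finset.induction_on with
  | empty => simp
  | insert a s ha ih =>
    rw [Finset.sum_insert ha, Finset.prod_insert ha]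
    have hp : ∏ i ∈ s, (1 - f i) ≤ 1 :=
      Finset.prod_le_one (fun i _ => by linarith [h1 i]) (fun i _ => by linarith [h0 i])
    nlinarith [h0 a, h1 a]

/-- Sums of coordinates in terms of the Euclidean length. -/
lemma sum_le_sqrt_card_mul {ι : Type*} [Fintype ι] (v : ι → ℝ) :
    ∑ i, v i ≤ √(Fintype.card ι) * √(∑ i, v i ^ 2) := by
  rw [← Real.sqrt_mul (by positivity)]
  apply Real.le_sqrt_of_sq_le
  have := sq_sum_le_card_mul_sum_sq (s := (Finset.univ : Finset ι)) (f := v)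
  simpa using this

/-- The rounding estimate inside the unit cube, at the critical exponent. The right side is a convex
combination of 1 and `2⁻ⁿ`, so `r ≥ 1` is immediate; for `r < 1` the product is bounded below by `(1
- r²) / (1 + r/√n)ⁿ`. -/
lemma inv_one_add_pow_le {ι : Type*} [Fintype ι] [Nonempty ι] (v : ι → ℝ)
    (h0 : ∀ i, 0 ≤ v i) (h1 : ∀ i, v i ≤ 1) :
    ((1 + √(∑ i, v i ^ 2)) ^ Fintype.card ι)⁻¹ ≤
      ∏ i, (1 - v i) + (1 - ∏ i, (1 - v i)) * ((2 : ℝ) ^ Fintype.card ι)⁻¹ := by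
  set n := Fintype.card ι with hn
  have hnpos : 0 < n := Fintype.card_pos
  set r := √(∑ i, v i ^ 2) with hr
  set π := ∏ i, (1 - v i) with hπ
  have hr0 : 0 ≤ r := Real.sqrt_nonneg _
  have hπ0 : 0 ≤ π := Finset.prod_nonneg fun i _ => by linarith [h1 i]
  have hinv : ((2 : ℝ) ^ n)⁻¹ ≤ 1 := inv_le_one_of_one_le₀ (one_le_pow₀ (by norm_num))
  rcases le_or_gt 1 r with h | h
  · have : ((1 + r) ^ n)⁻¹ ≤ ((2 : ℝ) ^ n)⁻¹ := by
      gcongr; linarith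
    nlinarith
  have hr2 : r ^ 2 = ∑ i, v i ^ 2 := Real.sq_sqrt (Finset.sum_nonneg fun i _ => sq_nonneg _)
  have hsn : 0 < √(n : ℝ) := Real.sqrt_pos.2 (by exact_mod_cast hnpos)
  -- Weierstrass' product inequality for the numbers `v i ^ 2`, with `1 - v² = (1 - v)(1 + v)`.
  have hW : 1 - r ^ 2 ≤ π * ∏ i, (1 + v i) := by
    rw [hr2, hπ, ← Finset.prod_mul_distrib]
    refine (one_sub_sum_le_prod _ (fun i => v i ^ 2) (fun i => sq_nonneg _)
      (fun i => by nlinarith [h0 i, h1 i])).trans (le_of_eq ?_)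
    exact Finset.prod_congr rfl fun i _ => by ring
  -- The arithmetic-geometric mean inequality, with the mean of the `v i` bounded by `r/√n` through
  -- Cauchy–Schwarz.
  have hAM : ∏ i, (1 + v i) ≤ (1 + r / √n) ^ n := by
    have := Real.geom_mean_le_arith_mean_weighted (Finset.univ : Finset ι)
      (fun _ => (1 : ℝ) / n) (fun i => 1 + v i) (fun i _ => by positivity)
      (by simp [← hn]) (fun i _ => by linarith [h0 i])
    rw [Real.finsetProd_rpow _ _ (fun i _ => by linarith [h0 i])] at this
    have h3 : ∑ i, 1 / (n : ℝ) * (1 + v i) ≤ 1 + r / √n := by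
      rw [← Finset.mul_sum, Finset.sum_add_distrib]
      simp only [Finset.sum_const, Finset.card_univ, ← hn, nsmul_eq_mul, mul_one]
      have h4 := sum_le_sqrt_card_mul v
      rw [← hn, ← hr] at h4
      have hsq : (n : ℝ) = √n * √n := (Real.mul_self_sqrt (by positivity)).symm
      have : r / √n = 1 / n * (√n * r) := by
        rw [one_div, div_eq_mul_inv]; nth_rw 2 [hsq]; field_simp
      rw [this, mul_add]
      have h5 : 1 / (n : ℝ) * n = 1 := by field_simp
      rw [h5]
      have : 1 / (n : ℝ) * ∑ i, v i ≤ 1 / n * (√n * r) := by gcongr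
      linarith
    have h6 := this.trans h3
    have hp0 : 0 ≤ ∏ i, (1 + v i) := Finset.prod_nonneg fun i _ => by linarith [h0 i]
    have h7 := pow_le_pow_left₀ (Real.rpow_nonneg hp0 _) h6 n
    rwa [← Real.rpow_natCast, ← Real.rpow_mul hp0, one_div,
      inv_mul_cancel₀ (by exact_mod_cast hnpos.ne'), Real.rpow_one] at h7
  have hs := one_add_div_sqrt_pow_mul_le hr0 h.le hnpos
  set S := (1 + r / √n) ^ n with hS
  have hSpos : 0 < S := by positivity
  have hπS : (1 - r) * (1 + r) ≤ π * S := by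
    have := mul_le_mul_of_nonneg_left hAM hπ0
    nlinarith
  have hR : 0 < (1 + r) ^ n := by positivity
  have h2n : (1 : ℝ) ≤ 2 ^ n := one_le_pow₀ (by norm_num)
  have key : (2 : ℝ) ^ n - (1 + r) ^ n ≤ π * ((1 + r) ^ n * (2 ^ n - 1)) := by
    have h8 : S * (2 ^ n - (1 + r) ^ n) ≤ S * (π * ((1 + r) ^ n * (2 ^ n - 1))) := by
      calc S * (2 ^ n - (1 + r) ^ n) ≤ (1 - r) * (1 + r) ^ (n + 1) * (2 ^ n - 1) := hs
        _ = ((1 - r) * (1 + r)) * ((1 + r) ^ n * (2 ^ n - 1)) := by ring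
        _ ≤ (π * S) * ((1 + r) ^ n * (2 ^ n - 1)) :=
          mul_le_mul_of_nonneg_right hπS (mul_nonneg hR.le (by linarith))
        _ = _ := by ring
    exact le_of_mul_le_mul_left h8 hSpos
  rw [inv_eq_one_div, div_le_iff₀ hR]
  have h2pos : (0 : ℝ) < 2 ^ n := by positivity
  have : (π + (1 - π) * ((2 : ℝ) ^ n)⁻¹) * (1 + r) ^ n =
      (π * ((1 + r) ^ n * (2 ^ n - 1)) + (1 + r) ^ n) / 2 ^ n := by
    field_simp; ring
  rw [this, le_div_iff₀ h2pos]
  linarith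

end MixedSampling

/-! ### Random rounding and lattice sums over translates. -/

namespace MixedSampling

/-- The probability with which `x` is rounded up (`true`) or down (`false`), so that the mean of
the rounded value is `x`. -/
def roundWeight (x : ℝ) (b : Bool) : ℝ := if b then Int.fract x else 1 - Int.fract x

/-- The offset of a rounding direction. -/
def roundStep (b : Bool) : ℤ := if b then 1 else 0

lemma roundWeight_nonneg (x : ℝ) (b : Bool) : 0 ≤ roundWeight x b := by
  unfold roundWeight
  split_ifs
  · exact Int.fract_nonneg x
  · linarith [Int.fract_lt_one x]

lemma sum_roundWeight (x : ℝ) : ∑ b, roundWeight x b = 1 := by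
  simp [roundWeight]

lemma sum_prod_roundWeight {ι : Type*} [Fintype ι] [DecidableEq ι] (z : ι → ℝ) :
    ∑ ε : ι → Bool, ∏ i, roundWeight (z i) (ε i) = 1 := by
  have := Finset.prod_univ_sum (fun _ : ι => (Finset.univ : Finset Bool))
    (fun i b => roundWeight (z i) b)
  rw [Fintype.piFinset_univ] at this
  rw [← this]
  exact Finset.prod_eq_one fun i _ => sum_roundWeight (z i)

lemma abs_floor_add_roundStep_le {x : ℝ} {n : ℕ} (hx : |x| < n + 1) (b : Bool) :
    |⌊x⌋ + roundStep b| ≤ n + 1 := by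
  rw [abs_lt] at hx
  have h1 : ⌊x⌋ < (n : ℤ) + 1 := Int.floor_lt.2 (by push_cast; exact hx.2)
  have h2 : -((n : ℤ) + 1) ≤ ⌊x⌋ := Int.le_floor.2 (by push_cast; linarith)
  unfold roundStep
  rw [abs_le]
  split_ifs <;> constructor <;> omega

/-- A rounded coordinate leaves `[-n, n]` only when `|x|` exceeds `n` and the rounding goes
outwards, which has probability `|x| - n`. -/
lemma one_sub_excess_le_sum_roundWeight {x : ℝ} {n : ℕ} (hx : |x| < n + 1) :
    1 - max (|x| - n) 0 ≤
      ∑ b, roundWeight x b * (if |⌊x⌋ + roundStep b| ≤ (n : ℤ) then 1 else 0) := by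
  rw [abs_lt] at hx
  have h1 : ⌊x⌋ < (n : ℤ) + 1 := Int.floor_lt.2 (by push_cast; exact hx.2)
  have h2 : -((n : ℤ) + 1) ≤ ⌊x⌋ := Int.le_floor.2 (by push_cast; linarith)
  have hf0 := Int.fract_nonneg x
  have hf1 := Int.fract_lt_one x
  have hfl := Int.floor_add_fract x
  simp only [Fintype.sum_bool, roundWeight, roundStep, if_true, Bool.false_eq_true, if_false,
    add_zero, abs_le]
  rcases eq_or_lt_of_le h2 with h | h
  · have hF : (⌊x⌋ : ℝ) = -(n + 1) := by rw [← h]; push_cast; ring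
    have hA : -(n : ℤ) ≤ ⌊x⌋ + 1 ∧ ⌊x⌋ + 1 ≤ n := by omega
    have hB : ¬ (-(n : ℤ) ≤ ⌊x⌋ ∧ ⌊x⌋ ≤ n) := by omega
    rw [if_pos hA, if_neg hB]
    have : -x ≤ |x| := neg_le_abs x
    have := le_max_left (|x| - n) 0
    linarith
  · have hB : -(n : ℤ) ≤ ⌊x⌋ ∧ ⌊x⌋ ≤ n := by omega
    rw [if_pos hB]
    by_cases hA : -(n : ℤ) ≤ ⌊x⌋ + 1 ∧ ⌊x⌋ + 1 ≤ n
    · rw [if_pos hA]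
      have := le_max_right (|x| - n) 0
      linarith
    · rw [if_neg hA]
      have hF : ⌊x⌋ = n := by omega
      have hF' : (⌊x⌋ : ℝ) = n := by rw [hF]; simp
      have : x ≤ |x| := le_abs_self x
      have := le_max_left (|x| - n) 0
      linarith

/-- If only `i₀` exceeds `n`, its length alone suffices. Any second exceeding coordinate adds a
whole `n²` to the squared length, which for `n ≥ 1` pays for everything else. -/
lemma add_one_sub_prod_le_sqrt {ι : Type*} [Fintype ι] (z v : ι → ℝ) {n : ℝ} (hn : 1 ≤ n)
    (h0 : ∀ i, 0 ≤ v i) (h1 : ∀ i, v i ≤ 1) (hz : ∀ i, 0 < v i → |z i| = n + v i)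
    {i₀ : ι} (hi₀ : |z i₀| = n + v i₀) :
    n + (1 - ∏ i, (1 - v i)) ≤ √(∑ i, z i ^ 2) := by
  classical
  apply Real.le_sqrt_of_sq_le
  rw [← Finset.add_sum_erase _ _ (Finset.mem_univ i₀),
    ← Finset.mul_prod_erase _ _ (Finset.mem_univ i₀)]
  set T := Finset.univ.erase i₀ with hT
  set π := ∏ i ∈ T, (1 - v i) with hπ
  have hπ0 : 0 ≤ π := Finset.prod_nonneg fun i _ => by linarith [h1 i]
  have hπ1 : π ≤ 1 :=
    Finset.prod_le_one (fun i _ => by linarith [h1 i]) (fun i _ => by linarith [h0 i])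
  have hW : 1 - ∑ i ∈ T, v i ≤ π := one_sub_sum_le_prod T v h0 h1
  have hzi : z i₀ ^ 2 = (n + v i₀) ^ 2 := by rw [← hi₀, sq_abs]
  rw [hzi]
  have hx0 := h0 i₀
  have hx1 := h1 i₀
  set x := v i₀
  by_cases hTv : ∀ i ∈ T, v i = 0
  · have : π = 1 := Finset.prod_eq_one fun i hi => by rw [hTv i hi]; ring
    rw [this]
    have : 0 ≤ ∑ i ∈ T, z i ^ 2 := Finset.sum_nonneg fun i _ => sq_nonneg _
    nlinarith
  · push Not at hTv
    obtain ⟨j, hj, hvj⟩ := hTv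
    have hsum : n ^ 2 + 2 * n * ∑ i ∈ T, v i ≤ ∑ i ∈ T, z i ^ 2 := by
      have hterm : ∀ i, 2 * n * v i ≤ z i ^ 2 := fun i => by
        rcases (h0 i).eq_or_lt with h | h
        · rw [← h]; simp; positivity
        · rw [← sq_abs, hz i h]; nlinarith
      have hjj : n ^ 2 + 2 * n * v j ≤ z j ^ 2 := by
        rw [← sq_abs (z j), hz j (lt_of_le_of_ne (h0 j) (Ne.symm hvj))]; nlinarith [h0 j]
      rw [← Finset.add_sum_erase _ _ hj, ← Finset.add_sum_erase _ (fun i => z i ^ 2) hj]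
      have : 2 * n * ∑ i ∈ T.erase j, v i ≤ ∑ i ∈ T.erase j, z i ^ 2 := by
        rw [Finset.mul_sum]; exact Finset.sum_le_sum fun i _ => hterm i
      linarith
    set e := 1 - π with he
    have hπe : π = 1 - e := by rw [he]; ring
    have he0 : 0 ≤ e := by linarith
    have he1 : e ≤ 1 := by linarith
    have h3 : 2 * n * e ≤ 2 * n * ∑ i ∈ T, v i := by
      apply mul_le_mul_of_nonneg_left _ (by linarith); linarith
    rw [hπe]
    have e1 : n + (1 - (1 - x) * (1 - e)) = (n + x) + (1 - x) * e := by ring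
    rw [e1]
    -- The quadratic term is at most 1, hence absorbed by the extra `n²`; this is where `1 ≤ n`
    -- enters.
    have h4 : (1 - x) ^ 2 * e ^ 2 ≤ n ^ 2 := by
      have a1 : (1 - x) * e ≤ 1 := by nlinarith
      have a2 : 0 ≤ (1 - x) * e := mul_nonneg (by linarith) he0
      nlinarith
    have h5 : 0 ≤ x * e := mul_nonneg hx0 he0
    have h6 : x * e * x ≥ 0 := mul_nonneg h5 hx0
    nlinarith

/-- Convexity of the reciprocal: it lies below its chord. -/
lemma inv_add_le_of_mem_Icc {x e : ℝ} (hx : 0 < x) (h0 : 0 ≤ e) (h1 : e ≤ 1) :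
    (x + e)⁻¹ ≤ (1 - e) * x⁻¹ + e * (x + 1)⁻¹ := by
  have : (1 - e) * x⁻¹ + e * (x + 1)⁻¹ = (x + 1 - e) / (x * (x + 1)) := by
    field_simp; ring
  rw [this, inv_eq_one_div, div_le_div_iff₀ (by linarith) (by positivity)]
  nlinarith

lemma rpow_convex_comb_le {π X Y p : ℝ} (hπ0 : 0 ≤ π) (hπ1 : π ≤ 1) (hX : 0 ≤ X) (hY : 0 ≤ Y)
    (hp : 1 ≤ p) : (π * X + (1 - π) * Y) ^ p ≤ π * X ^ p + (1 - π) * Y ^ p := by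
  have := (convexOn_rpow hp).2 (x := X) (y := Y) hX hY hπ0 (sub_nonneg.2 hπ1) (by ring)
  simpa using this

/-- The profile `(1 + u)⁻ᵃ` at a point of Euclidean length `u` is at most its mean over a random
rounding of the point to the integer lattice, the length being measured there in the maximum
norm. -/
lemma inv_one_add_rpow_le_sum_roundWeight {ι : Type*} [Fintype ι] [DecidableEq ι] [Nonempty ι]
    (z : ι → ℝ) {a : ℝ} (ha : (Fintype.card ι : ℝ) ≤ a) :
    (1 + √(∑ i, z i ^ 2))⁻¹ ^ a ≤
      ∑ ε : ι → Bool, (∏ i, roundWeight (z i) (ε i)) *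
        (1 + ‖fun i => ⌊z i⌋ + roundStep (ε i)‖)⁻¹ ^ a := by
  have hcard : (1 : ℝ) ≤ Fintype.card ι := by exact_mod_cast Fintype.card_pos (α := ι)
  have ha0 : 0 ≤ a := by linarith
  set n := ⌊‖z‖⌋₊ with hn
  have hlt : ∀ i, |z i| < n + 1 := fun i =>
    (norm_le_pi_norm z i).trans_lt (Nat.lt_floor_add_one _)
  obtain ⟨i₀, hi₀⟩ : ∃ i, ‖z‖ = |z i| := by
    obtain ⟨i, hi⟩ := Finite.exists_max fun i => |z i|
    exact ⟨i, le_antisymm ((pi_norm_le_iff_of_nonneg (abs_nonneg _)).2 hi) (norm_le_pi_norm z i)⟩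
  have hni₀ : (n : ℝ) ≤ |z i₀| := hi₀ ▸ Nat.floor_le (norm_nonneg z)
  set v : ι → ℝ := fun i => max (|z i| - n) 0 with hv
  have hv0 : ∀ i, 0 ≤ v i := fun i => le_max_right _ _
  have hv1 : ∀ i, v i ≤ 1 := fun i => max_le (by linarith [hlt i]) zero_le_one
  set π := ∏ i, (1 - v i) with hπ
  have hπ0 : 0 ≤ π := Finset.prod_nonneg fun i _ => by linarith [hv1 i]
  have hπ1 : π ≤ 1 :=
    Finset.prod_le_one (fun i _ => by linarith [hv1 i]) (fun i _ => by linarith [hv0 i])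
  set κ₀ : ℝ := (1 + (n : ℝ))⁻¹ ^ a with hκ₀
  set κ₁ : ℝ := (1 + (n : ℝ) + 1)⁻¹ ^ a with hκ₁
  have hκ : κ₁ ≤ κ₀ := Real.rpow_le_rpow (by positivity) (inv_anti₀ (by positivity) (by linarith)) ha0
  set good : (ι → Bool) → ℝ :=
    fun ε => ∏ i, (if |⌊z i⌋ + roundStep (ε i)| ≤ (n : ℤ) then 1 else 0) with hgood
  -- The rounded point has maximum norm at most `n + 1`, and at most `n` when every coordinate stays
  -- in `[-n, n]`. By independence of the coordinates the latter has probability at least `π`.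
  have hpt : ∀ ε, κ₁ + (κ₀ - κ₁) * good ε ≤
      (1 + ‖fun i => ⌊z i⌋ + roundStep (ε i)‖)⁻¹ ^ a := by
    intro ε
    by_cases hε : ∀ i, |⌊z i⌋ + roundStep (ε i)| ≤ (n : ℤ)
    · have : good ε = 1 := Finset.prod_eq_one fun i _ => if_pos (hε i)
      rw [this]
      have hle : ‖fun i => ⌊z i⌋ + roundStep (ε i)‖ ≤ n :=
        (pi_norm_le_iff_of_nonneg (by positivity)).2 fun i => by
          rw [Int.norm_eq_abs]; exact_mod_cast hε i
      have : κ₀ ≤ (1 + ‖fun i => ⌊z i⌋ + roundStep (ε i)‖)⁻¹ ^ a :=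
        Real.rpow_le_rpow (by positivity) (by gcongr) ha0
      linarith
    · push Not at hε
      obtain ⟨i, hi⟩ := hε
      have : good ε = 0 := Finset.prod_eq_zero (Finset.mem_univ i) (if_neg (not_le.2 hi))
      rw [this]
      have hle : ‖fun i => ⌊z i⌋ + roundStep (ε i)‖ ≤ n + 1 :=
        (pi_norm_le_iff_of_nonneg (by positivity)).2 fun i => by
          rw [Int.norm_eq_abs]; exact_mod_cast abs_floor_add_roundStep_le (hlt i) (ε i)
      have : κ₁ ≤ (1 + ‖fun i => ⌊z i⌋ + roundStep (ε i)‖)⁻¹ ^ a :=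
        Real.rpow_le_rpow (by positivity) (inv_anti₀ (by positivity) (by linarith)) ha0
      linarith
  have hW1 : ∑ ε : ι → Bool, ∏ i, roundWeight (z i) (ε i) = 1 :=
    sum_prod_roundWeight z
  have hWg : π ≤ ∑ ε : ι → Bool, (∏ i, roundWeight (z i) (ε i)) * good ε := by
    have := Finset.prod_univ_sum (fun _ : ι => (Finset.univ : Finset Bool))
      (fun i b => roundWeight (z i) b * (if |⌊z i⌋ + roundStep b| ≤ (n : ℤ) then (1 : ℝ) else 0))
    rw [Fintype.piFinset_univ] at this
    simp only [hgood, ← Finset.prod_mul_distrib]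
    rw [← this]
    exact Finset.prod_le_prod (fun i _ => by linarith [hv1 i])
      fun i _ => one_sub_excess_le_sum_roundWeight (hlt i)
  have hE : π * κ₀ + (1 - π) * κ₁ ≤ ∑ ε : ι → Bool, (∏ i, roundWeight (z i) (ε i)) *
        (1 + ‖fun i => ⌊z i⌋ + roundStep (ε i)‖)⁻¹ ^ a := by
    calc π * κ₀ + (1 - π) * κ₁ = κ₁ + (κ₀ - κ₁) * π := by ring
      _ ≤ κ₁ + (κ₀ - κ₁) * ∑ ε : ι → Bool, (∏ i, roundWeight (z i) (ε i)) * good ε := by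
        have := mul_le_mul_of_nonneg_left hWg (sub_nonneg.2 hκ)
        linarith
      _ = ∑ ε : ι → Bool, (∏ i, roundWeight (z i) (ε i)) * (κ₁ + (κ₀ - κ₁) * good ε) := by
        simp only [mul_add, Finset.sum_add_distrib, ← Finset.sum_mul, hW1, one_mul]
        rw [Finset.mul_sum]
        congr 1
        exact Finset.sum_congr rfl fun ε _ => by ring
      _ ≤ _ := Finset.sum_le_sum fun ε _ => mul_le_mul_of_nonneg_left (hpt ε)
        (Finset.prod_nonneg fun i _ => roundWeight_nonneg _ _)
  refine le_trans ?_ hE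
  set R := √(∑ i, z i ^ 2) with hR
  have hR0 : 0 ≤ R := Real.sqrt_nonneg _
  -- For `n = 0` the bound `1 - π ≤ R` can fail, so the inequality is taken at exponent `d` and
  -- raised to the power `a/d ≥ 1` by convexity; this uses `d ≤ a`. For `n ≥ 1` one has `n + (1 - π)
  -- ≤ R`, and convexity of the reciprocal and of the power suffices.
  rcases Nat.eq_zero_or_pos n with h | h
  · have hvz : ∀ i, v i = |z i| := fun i => by simp [hv, h]
    have hc := inv_one_add_pow_le v hv0 hv1
    simp only [hvz, sq_abs] at hc
    rw [← hR, show ∏ i, (1 - |z i|) = π from by simp [hπ, hvz]] at hc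
    set d := Fintype.card ι
    have hd : (d : ℝ) ≠ 0 := by positivity
    have hexp : ∀ x : ℝ, 0 ≤ x → x⁻¹ ^ a = ((x ^ d)⁻¹) ^ (a / d) := fun x hx => by
      rw [← inv_pow, ← Real.rpow_natCast, ← Real.rpow_mul (by positivity), mul_div_cancel₀ _ hd]
    rw [hexp _ (by positivity), hκ₀, hκ₁, h]
    norm_num only [Nat.cast_zero, add_zero, inv_one, Real.one_rpow]
    rw [show (1 / 2 : ℝ) = 2⁻¹ by norm_num, hexp 2 (by norm_num)]
    refine (Real.rpow_le_rpow (by positivity) hc (by positivity)).trans ?_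
    have := rpow_convex_comb_le (X := 1) (Y := ((2 : ℝ) ^ d)⁻¹) (p := a / d) hπ0 hπ1 zero_le_one
      (by positivity) ((one_le_div (by positivity)).2 ha)
    simpa using this
  · have hkey : n + (1 - π) ≤ R := by
      refine add_one_sub_prod_le_sqrt z v (by exact_mod_cast h) hv0 hv1 (i₀ := i₀) ?_ ?_
      · intro i hi
        have : v i = |z i| - n := by
          rcases max_choice (|z i| - n) 0 with h' | h'
          · exact h'
          · exact absurd h' hi.ne'
        rw [this]; ring
      · have : v i₀ = |z i₀| - n := max_eq_left (by linarith)
        rw [this]; ring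
    have h1 : (1 + R)⁻¹ ≤ π * (1 + (n : ℝ))⁻¹ + (1 - π) * (1 + (n : ℝ) + 1)⁻¹ := by
      have h2 := inv_add_le_of_mem_Icc (x := 1 + (n : ℝ)) (e := 1 - π) (by positivity)
        (by linarith) (by linarith)
      have h3 : (1 + R)⁻¹ ≤ (1 + (n : ℝ) + (1 - π))⁻¹ :=
        inv_anti₀ (by have : (0 : ℝ) ≤ n := by positivity
                      linarith) (by linarith)
      refine h3.trans (h2.trans (le_of_eq ?_)); ring
    exact (Real.rpow_le_rpow (by positivity) h1 ha0).trans
      (rpow_convex_comb_le hπ0 hπ1 (by positivity) (by positivity) (by linarith))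

/-- Among the translates of `ℤᵈ`, measured by Euclidean length, none has a larger sum of
`(1 + length)⁻ᵃ` than `ℤᵈ` itself measured in the maximum norm. -/
lemma tsum_translate_le {ι : Type*} [Fintype ι] [DecidableEq ι] [Nonempty ι] (y : ι → ℝ) {a : ℝ}
    (ha : (Fintype.card ι : ℝ) ≤ a) :
    ∑' k : ι → ℤ, ENNReal.ofReal ((1 + √(∑ i, (y i - k i) ^ 2))⁻¹ ^ a) ≤
      ∑' k : ι → ℤ, ENNReal.ofReal ((1 + ‖k‖)⁻¹ ^ a) := by
  have hW1 : ∑ ε : ι → Bool, ∏ i, roundWeight (y i) (ε i) = 1 :=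
    sum_prod_roundWeight y
  have hw0 : ∀ ε : ι → Bool, 0 ≤ ∏ i, roundWeight (y i) (ε i) := fun ε =>
    Finset.prod_nonneg fun i _ => roundWeight_nonneg _ _
  -- Subtracting an integer leaves the fractional part unchanged, so one random rounding of `y`,
  -- with the same weights, serves every `k`.
  have hpt : ∀ k : ι → ℤ, ENNReal.ofReal ((1 + √(∑ i, (y i - k i) ^ 2))⁻¹ ^ a) ≤
      ∑ ε : ι → Bool, ENNReal.ofReal (∏ i, roundWeight (y i) (ε i)) *
        ENNReal.ofReal ((1 + ‖(fun i => ⌊y i⌋ + roundStep (ε i)) - k‖)⁻¹ ^ a) := by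
    intro k
    have := inv_one_add_rpow_le_sum_roundWeight (fun i => y i - k i) ha
    refine (ENNReal.ofReal_le_ofReal this).trans (le_of_eq ?_)
    rw [ENNReal.ofReal_sum_of_nonneg]
    · refine Finset.sum_congr rfl fun ε _ => ?_
      rw [ENNReal.ofReal_mul (Finset.prod_nonneg fun i _ => roundWeight_nonneg _ _)]
      congr 4
      · funext i; simp [roundWeight]
      · congr 2; funext i; simp; ring
    · intro ε _
      exact mul_nonneg (Finset.prod_nonneg fun i _ => roundWeight_nonneg _ _) (by positivity)
  refine (ENNReal.tsum_le_tsum hpt).trans (le_of_eq ?_)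
  rw [Summable.tsum_finsetSum fun _ _ => ENNReal.summable]
  simp_rw [ENNReal.tsum_mul_left]
  -- For each rounding the sum runs over an integer translate of the lattice, so it does not depend
  -- on the rounding and the weights add up to 1.
  have hshift : ∀ w : ι → ℤ, ∑' k : ι → ℤ, ENNReal.ofReal ((1 + ‖w - k‖)⁻¹ ^ a) =
      ∑' k : ι → ℤ, ENNReal.ofReal ((1 + ‖k‖)⁻¹ ^ a) := fun w =>
    (Equiv.subLeft w).tsum_eq fun k => ENNReal.ofReal ((1 + ‖k‖)⁻¹ ^ a)
  simp_rw [hshift]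
  rw [← Finset.sum_mul, ← ENNReal.ofReal_sum_of_nonneg fun ε _ => hw0 ε, hW1]
  simp

end MixedSampling

/-! ### Subspaces of functions and the size of their nonvanishing sets. -/

namespace MixedSampling

/-- The linear combination `∑ j, c j • g j`. -/
def lincomb {𝓧 J : Type*} [Fintype J] (g : J → 𝓧 → ℂ) (c : J → ℂ) (x : 𝓧) : ℂ :=
  ∑ j, c j * g j x

section

variable {𝓧 J : Type*} [Fintype J] (g : J → 𝓧 → ℂ)

lemma lincomb_add (c c' : J → ℂ) (x : 𝓧) :
    lincomb g (c + c') x = lincomb g c x + lincomb g c' x := by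
  simp [lincomb, add_mul, Finset.sum_add_distrib]

lemma lincomb_smul (a : ℂ) (c : J → ℂ) (x : 𝓧) :
    lincomb g (a • c) x = a * lincomb g c x := by
  simp [lincomb, Finset.mul_sum, mul_assoc]

/-- Evaluation of the linear combination at `x`, as a functional of the coefficients. -/
def evalAt (x : 𝓧) : (J → ℂ) →ₗ[ℂ] ℂ where
  toFun c := lincomb g c x
  map_add' c c' := lincomb_add g c c' x
  map_smul' a c := lincomb_smul g a c x

@[simp]
lemma evalAt_apply (x : 𝓧) (c : J → ℂ) : evalAt g x c = lincomb g c x := rfl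

/-- The points at which some combination with coefficients in `W` does not vanish. -/
def nonvanishing (W : Submodule ℂ (J → ℂ)) : Set 𝓧 := {x | ∃ c ∈ W, lincomb g c x ≠ 0}

variable [MeasurableSpace 𝓧] {g}

lemma measurable_lincomb (hg : ∀ j, Measurable (g j)) (c : J → ℂ) : Measurable (lincomb g c) := by
  unfold lincomb
  fun_prop

lemma measurableSet_nonvanishing (hg : ∀ j, Measurable (g j)) (W : Submodule ℂ (J → ℂ)) :
    MeasurableSet (nonvanishing g W) := by
  let b := Module.finBasis ℂ W
  have : nonvanishing g W = ⋃ k, {x | lincomb g (b k : J → ℂ) x ≠ 0} := by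
    ext x
    simp only [nonvanishing, Set.mem_ofPred_eq, Set.mem_iUnion]
    constructor
    · rintro ⟨c, hc, hne⟩
      by_contra! h
      apply hne
      have h0 : (evalAt g x).comp W.subtype = 0 := b.ext fun k => by simpa using h k
      simpa using LinearMap.congr_fun h0 ⟨c, hc⟩
    · rintro ⟨k, hk⟩
      exact ⟨b k, (b k).2, hk⟩
  rw [this]
  exact MeasurableSet.iUnion fun k =>
    (measurable_lincomb hg _) (measurableSet_singleton 0).compl

variable {μ : Measure 𝓧} [IsProbabilityMeasure μ] {Nm : (J → ℂ) → ℝ}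

lemma memLp_lincomb (hg : ∀ j, Measurable (g j)) (hb : ∀ c x, ‖lincomb g c x‖ ≤ Nm c)
    (c : J → ℂ) : MemLp (lincomb g c) 2 μ :=
  MemLp.of_bound (measurable_lincomb hg c).aestronglyMeasurable (Nm c)
    (Filter.Eventually.of_forall (hb c))

variable (μ) in
/-- The linear combinations as elements of `L²`. -/
def lincombLp (hg : ∀ j, Measurable (g j)) (hb : ∀ c x, ‖lincomb g c x‖ ≤ Nm c) :
    (J → ℂ) →ₗ[ℂ] Lp ℂ 2 μ where
  toFun c := (memLp_lincomb hg hb c).toLp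
  map_add' c c' := by
    rw [← MemLp.toLp_add, MemLp.toLp_eq_toLp_iff]
    exact Filter.Eventually.of_forall fun x => lincomb_add g c c' x
  map_smul' a c := by
    rw [RingHom.id_apply, ← MemLp.toLp_const_smul, MemLp.toLp_eq_toLp_iff]
    exact Filter.Eventually.of_forall fun x => lincomb_smul g a c x

lemma norm_sq_lincombLp (hg : ∀ j, Measurable (g j)) (hb : ∀ c x, ‖lincomb g c x‖ ≤ Nm c)
    (c : J → ℂ) : ‖lincombLp μ hg hb c‖ ^ 2 = ∫ x, ‖lincomb g c x‖ ^ 2 ∂μ := by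
  have h1 : ((‖lincombLp μ hg hb c‖ ^ 2 : ℝ) : ℂ) =
      ((∫ x, ‖lincomb g c x‖ ^ 2 ∂μ : ℝ) : ℂ) := by
    have h := inner_self_eq_norm_sq_to_K (𝕜 := ℂ) (lincombLp μ hg hb c)
    rw [L2.inner_def] at h
    push_cast
    refine Eq.trans h.symm ?_
    rw [← integral_complex_ofReal]
    refine integral_congr_ae ?_
    filter_upwards [(memLp_lincomb (μ := μ) hg hb c).coeFn_toLp] with x hx
    have : (lincombLp μ hg hb c : 𝓧 → ℂ) x = lincomb g c x := hx
    rw [this, inner_self_eq_norm_sq_to_K]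
    simp
  exact_mod_cast h1

lemma integrable_norm_sq_lincomb (hg : ∀ j, Measurable (g j))
    (hb : ∀ c x, ‖lincomb g c x‖ ≤ Nm c) (c : J → ℂ) :
    Integrable (fun x => ‖lincomb g c x‖ ^ 2) μ :=
  (memLp_two_iff_integrable_sq_norm (measurable_lincomb hg c).aestronglyMeasurable).1
    (memLp_lincomb hg hb c)

/-- A space of functions on which the `L¹` norm is at least `t` times a norm dominating the
supremum norm: its members cannot all vanish outside a set of probability less than
`t √(dim)`. -/
lemma mul_sqrt_finrank_le_nonvanishing (hg : ∀ j, Measurable (g j))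
    (hb : ∀ c x, ‖lincomb g c x‖ ≤ Nm c) {t : ℝ} (ht : 0 < t)
    (hl : ∀ c, t * Nm c ≤ ∫ x, ‖lincomb g c x‖ ∂μ) (hpos : ∀ c, c ≠ 0 → 0 < Nm c)
    (W : Submodule ℂ (J → ℂ)) :
    t * √(Module.finrank ℂ W) ≤ μ.real (nonvanishing g W) := by
  set T := lincombLp μ hg hb with hT
  have hTinj : Function.Injective T := by
    rw [injective_iff_map_eq_zero]
    intro c hc
    by_contra hne
    have h0 : ∫ x, ‖lincomb g c x‖ ^ 2 ∂μ = 0 := by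
      rw [← norm_sq_lincombLp hg hb c, ← hT, hc]; simp
    rw [integral_eq_zero_iff_of_nonneg (fun x => by positivity)
      (integrable_norm_sq_lincomb hg hb c)] at h0
    have h1 : ∫ x, ‖lincomb g c x‖ ∂μ = 0 := by
      rw [← integral_zero 𝓧 ℝ (μ := μ)]
      refine integral_congr_ae ?_
      filter_upwards [h0] with x hx
      simpa using hx
    have := hl c
    rw [h1] at this
    have := mul_pos ht (hpos c hne)
    linarith
  set A := nonvanishing g W with hA
  have hAm : MeasurableSet A := measurableSet_nonvanishing hg W
  set p := μ.real A with hp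
  let S : Submodule ℂ (Lp ℂ 2 μ) := W.map T
  have hfin : Module.finrank ℂ S = Module.finrank ℂ W :=
    (LinearEquiv.finrank_eq (Submodule.equivMapOfInjective T hTinj W)).symm
  let b := stdOrthonormalBasis ℂ S
  have hbW : ∀ i, ∃ c ∈ W, T c = b i := fun i => (Submodule.mem_map).1 (b i).2
  choose e heW heT using hbW
  -- The diagonal of the reproducing kernel of `W`, built from an orthonormal basis in `L²(μ)`.
  set s : 𝓧 → ℝ := fun x => ∑ i, ‖lincomb g (e i) x‖ ^ 2 with hs
  have hs0 : ∀ x, 0 ≤ s x := fun x => Finset.sum_nonneg fun i _ => by positivity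
  have hsA : ∀ x, x ∉ A → s x = 0 := fun x hx => Finset.sum_eq_zero fun i _ => by
    have : lincomb g (e i) x = 0 := by
      by_contra h; exact hx ⟨e i, heW i, h⟩
    simp [this]
  have hbound : ∀ x, t ^ 2 * s x ≤ p := by
    intro x
    -- The kernel function at `x`: both its value at `x` and its squared `L²` norm equal `s x`.
    set c : J → ℂ := ∑ i, (starRingEnd ℂ (lincomb g (e i) x)) • e i with hc
    have hcW : c ∈ W := Submodule.sum_mem _ fun i _ => W.smul_mem _ (heW i)
    have hcx : lincomb g c x = (s x : ℂ) := by
      have : evalAt g x c = ∑ i, (starRingEnd ℂ (lincomb g (e i) x)) * lincomb g (e i) x := by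
        rw [hc, map_sum]; simp
      rw [evalAt_apply] at this
      rw [this, hs]
      push_cast
      exact Finset.sum_congr rfl fun i _ => Complex.conj_mul' _
    have hcn : ‖T c‖ ^ 2 = s x := by
      have h1 : T c = ((∑ i, (starRingEnd ℂ (lincomb g (e i) x)) • b i : S) : Lp ℂ 2 μ) := by
        rw [hc, map_sum]; push_cast
        exact Finset.sum_congr rfl fun i _ => by rw [map_smul, heT]
      have h2 := b.orthonormal.inner_sum (fun i => starRingEnd ℂ (lincomb g (e i) x))
        (fun i => starRingEnd ℂ (lincomb g (e i) x)) Finset.univ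
      rw [inner_self_eq_norm_sq_to_K] at h2
      have h3 : ((‖T c‖ ^ 2 : ℝ) : ℂ) = (s x : ℂ) := by
        rw [h1, ← Submodule.coe_norm, Complex.ofReal_pow]
        refine Eq.trans h2 ?_
        rw [hs]; push_cast
        exact Finset.sum_congr rfl fun i _ => by rw [Complex.conj_conj, Complex.mul_conj']
      exact_mod_cast h3
    rw [norm_sq_lincombLp] at hcn
    -- Cauchy–Schwarz on `A` in the form `2u ≤ t⁻¹ + t u²`. The weight `t` lets `t * s x`, which is
    -- a lower bound for the integral, be absorbed.
    have hint : ∫ y, ‖lincomb g c y‖ ∂μ ≤ (p / t + t * s x) / 2 := by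
      have hi1 : Integrable (A.indicator fun _ => t⁻¹) μ :=
        (integrable_const _).indicator hAm
      have hi2 := (integrable_norm_sq_lincomb (μ := μ) hg hb c).const_mul t
      calc ∫ y, ‖lincomb g c y‖ ∂μ
          ≤ ∫ y, (A.indicator (fun _ => t⁻¹) y + t * ‖lincomb g c y‖ ^ 2) / 2 ∂μ := by
            refine integral_mono_of_nonneg (Filter.Eventually.of_forall fun y => norm_nonneg _)
              ((hi1.add hi2).div_const 2) (Filter.Eventually.of_forall fun y => ?_)
            by_cases hy : y ∈ A
            · simp only [Set.indicator_of_mem hy]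
              have hsq : 0 ≤ t⁻¹ * (1 - t * ‖lincomb g c y‖) ^ 2 := by positivity
              have : t⁻¹ * (1 - t * ‖lincomb g c y‖) ^ 2 =
                  t⁻¹ - 2 * ‖lincomb g c y‖ + t * ‖lincomb g c y‖ ^ 2 := by
                field_simp; ring
              linarith
            · have h0 : lincomb g c y = 0 := by
                by_contra h; exact hy ⟨c, hcW, h⟩
              simp [h0, Set.indicator_of_notMem hy]
        _ = (p / t + t * s x) / 2 := by
            rw [integral_div, integral_add hi1 hi2, integral_const_mul, hcn,
              integral_indicator_const _ hAm, smul_eq_mul, div_eq_mul_inv p t]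
    have h4 : t * s x ≤ t * Nm c := by
      apply mul_le_mul_of_nonneg_left _ ht.le
      have := hb c x
      rw [hcx] at this
      simpa [abs_of_nonneg (hs0 x)] using this
    have h5 : t * s x ≤ p / t := by linarith [hl c]
    rw [le_div_iff₀ ht] at h5
    linarith
  have hsint : ∫ x, s x ∂μ = Module.finrank ℂ W := by
    rw [hs, integral_finsetSum _ fun i _ => integrable_norm_sq_lincomb hg hb (e i)]
    have : ∀ i, ∫ x, ‖lincomb g (e i) x‖ ^ 2 ∂μ = 1 := fun i => by
      rw [← norm_sq_lincombLp hg hb, ← hT, heT]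
      have := b.orthonormal.1 i
      rw [← Submodule.coe_norm, this]; norm_num
    simp [this, hfin]
  -- The integral of `s` is the dimension, while `s ≤ p / t²` on `A` and `s = 0` elsewhere;
  -- integrating produces the second factor `p`.
  have hle : t ^ 2 * Module.finrank ℂ W ≤ p ^ 2 := by
    rw [← hsint, ← integral_const_mul]
    calc ∫ x, t ^ 2 * s x ∂μ ≤ ∫ x, A.indicator (fun _ => p) x ∂μ := by
          refine integral_mono_of_nonneg
            (Filter.Eventually.of_forall fun x => mul_nonneg (by positivity) (hs0 x))
            ((integrable_const _).indicator hAm) (Filter.Eventually.of_forall fun x => ?_)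
          by_cases hx : x ∈ A
          · simpa [Set.indicator_of_mem hx] using hbound x
          · simp [Set.indicator_of_notMem hx, hsA x hx]
      _ = p ^ 2 := by rw [integral_indicator_const _ hAm, smul_eq_mul, sq]
  have hp0 : 0 ≤ p := measureReal_nonneg
  refine (pow_le_pow_iff_left₀ (by positivity) hp0 two_ne_zero).1 ?_
  rw [mul_pow, Real.sq_sqrt (by positivity)]
  exact hle

end

/-! ### Dimension drop along independent samples. -/

/-- The potential of a kernel of dimension `m` in the dimension-drop argument. -/
def dropPotential (t : ℝ) (m : ℕ) : ℝ := if m = 0 then 0 else 1 + t * √m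

lemma dropPotential_nonneg {t : ℝ} (ht : 0 ≤ t) (m : ℕ) : 0 ≤ dropPotential t m := by
  unfold dropPotential; split_ifs <;> positivity

lemma dropPotential_mono {t : ℝ} (ht : 0 ≤ t) : Monotone (dropPotential t) := by
  intro a b hab
  unfold dropPotential
  split_ifs with h1 h2 h2
  · exact le_rfl
  · positivity
  · omega
  · gcongr

/-- For `m > 1` a drop in dimension gains `t(√m - √(m-1)) ≥ t/(2√m)`, so with `p ≥ t√m` the mean
gain is at least `t²/2`; the potential is at most 2 because `t√m ≤ 1`. For `m = 1` the whole
potential is lost, with probability at least `t`. -/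
lemma dropPotential_step {t p : ℝ} (ht : 0 < t) {m : ℕ} (hm : 0 < m) (hp : t * √m ≤ p)
    (hp1 : p ≤ 1) :
    p * dropPotential t (m - 1) + (1 - p) * dropPotential t m ≤
      (1 - t ^ 2 / 8) * dropPotential t m := by
  have hsm : 1 ≤ √(m : ℝ) := by rw [Real.one_le_sqrt]; exact_mod_cast hm
  have ht1 : t ≤ 1 := by nlinarith
  have hF : dropPotential t m = 1 + t * √m := by simp [dropPotential, hm.ne']
  suffices h : t ^ 2 / 8 * dropPotential t m ≤
      p * (dropPotential t m - dropPotential t (m - 1)) by linarith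
  rcases Nat.eq_or_lt_of_le (Nat.succ_le_of_lt hm) with h1 | h1
  · have h0 : dropPotential t (m - 1) = 0 := by simp [dropPotential, ← h1]
    rw [h0, sub_zero]
    apply mul_le_mul_of_nonneg_right _ (dropPotential_nonneg ht.le m)
    nlinarith
  · have hF1 : dropPotential t (m - 1) = 1 + t * √(m - 1 : ℕ) := by
      have : m - 1 ≠ 0 := by omega
      simp [dropPotential, this]
    rw [hF, hF1]
    set x := √(m : ℝ) with hx
    set y := √((m - 1 : ℕ) : ℝ) with hy
    have hx2 : x ^ 2 = m := Real.sq_sqrt (by positivity)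
    have hy2 : y ^ 2 = m - 1 := by
      rw [hy, Real.sq_sqrt (by positivity), Nat.cast_sub (by omega)]; simp
    have hy0 : 0 ≤ y := Real.sqrt_nonneg _
    have hyx : y ≤ x := by nlinarith
    -- From `(x - y)(x + y) = 1` and `x + y ≤ 2x`.
    have hxy : 1 / 2 ≤ x * (x - y) := by nlinarith
    have h3 : t * x * (t * (x - y)) ≤ p * (t * (x - y)) :=
      mul_le_mul_of_nonneg_right hp (mul_nonneg ht.le (by linarith))
    have h4 : t ^ 2 / 8 * (1 + t * x) ≤ t ^ 2 / 8 * 2 := by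
      apply mul_le_mul_of_nonneg_left _ (by positivity); linarith
    have h5 : t ^ 2 * (1 / 2) ≤ t ^ 2 * (x * (x - y)) :=
      mul_le_mul_of_nonneg_left hxy (by positivity)
    nlinarith

section

variable {𝓧 J : Type*} [Fintype J] {g : J → 𝓧 → ℂ}

/-- Linear independence of finitely many vectors is an open condition, which yields the
measurability of the degenerate samples. -/
lemma linearIndependent_eval_iff {ι κ : Type*} [Fintype κ] {W : Submodule ℂ (J → ℂ)}
    (b : Module.Basis κ ℂ W) (x : ι → 𝓧) :
    LinearIndependent ℂ (fun k i => lincomb g (b k : J → ℂ) (x i)) ↔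
      ∀ c ∈ W, (∀ i, lincomb g c (x i) = 0) → c = 0 := by
  let E : W →ₗ[ℂ] (ι → ℂ) := LinearMap.pi fun i => (evalAt g (x i)).comp W.subtype
  have h1 : (fun k i => lincomb g (b k : J → ℂ) (x i)) = E ∘ b := rfl
  have h2 : LinearIndependent ℂ (E ∘ b) ↔ LinearMap.ker E = ⊥ := by
    constructor
    · intro h
      rw [LinearMap.ker_eq_bot']
      intro w hw
      have hr := b.sum_repr w
      rw [← hr, map_sum] at hw
      simp only [map_smul] at hw
      have h0 := Fintype.linearIndependent_iff.1 h _ hw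
      rw [← hr]
      exact Finset.sum_eq_zero fun k _ => by rw [h0 k, zero_smul]
    · intro h
      exact b.linearIndependent.map' E h
  rw [h1, h2, LinearMap.ker_eq_bot']
  constructor
  · intro h c hc hx
    have := h ⟨c, hc⟩ (by ext i; exact hx i)
    simpa using this
  · intro h w hw
    exact Subtype.ext (h w w.2 fun i => congrFun hw i)

/-- The samples at which some nonzero combination with coefficients in `W` vanishes. -/
def degenerateSamples (g : J → 𝓧 → ℂ) (W : Submodule ℂ (J → ℂ)) (ι : Type*) : Set (ι → 𝓧) :=
  {x | ∃ c ∈ W, c ≠ 0 ∧ ∀ i, lincomb g c (x i) = 0}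

variable [MeasurableSpace 𝓧]

lemma measurableSet_degenerateSamples (hg : ∀ j, Measurable (g j)) (W : Submodule ℂ (J → ℂ))
    (ι : Type*) [Fintype ι] : MeasurableSet (degenerateSamples g W ι) := by
  let b := Module.finBasis ℂ W
  have h1 : degenerateSamples g W ι =
      (fun (x : ι → 𝓧) k i => lincomb g (b k : J → ℂ) (x i)) ⁻¹'
        {v | LinearIndependent ℂ v}ᶜ := by
    ext x
    simp only [degenerateSamples, Set.mem_ofPred_eq, Set.mem_preimage, Set.mem_compl_iff,
      linearIndependent_eval_iff b x]
    push Not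
    exact ⟨fun ⟨c, h1, h2, h3⟩ => ⟨c, h1, h3, h2⟩, fun ⟨c, h1, h2, h3⟩ => ⟨c, h1, h3, h2⟩⟩
  rw [h1]
  have hm : Measurable (fun (x : ι → 𝓧) k i => lincomb g (b k : J → ℂ) (x i)) :=
    measurable_pi_lambda _ fun k => measurable_pi_lambda _ fun i =>
      (measurable_lincomb hg _).comp (measurable_pi_apply i)
  exact hm (isOpen_setOfPred_linearIndependent.measurableSet.compl)

variable {μ : Measure 𝓧} [IsProbabilityMeasure μ]

/-- Condition on the first point `x`: the other points must be degenerate for the members of `W`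
vanishing at `x`, a strictly smaller space when `x` is in the nonvanishing set. The potential bounds
the mean over `x`. -/
lemma pi_degenerateSamples_le (hg : ∀ j, Measurable (g j)) {t : ℝ} (ht : 0 < t)
    (hW : ∀ W : Submodule ℂ (J → ℂ), t * √(Module.finrank ℂ W) ≤ μ.real (nonvanishing g W))
    (ht1 : t ≤ 1) (n : ℕ) (W : Submodule ℂ (J → ℂ)) :
    (Measure.pi fun _ : Fin n => μ) (degenerateSamples g W (Fin n)) ≤
      ENNReal.ofReal ((1 - t ^ 2 / 8) ^ n * dropPotential t (Module.finrank ℂ W)) := by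
  have hκ : 0 ≤ 1 - t ^ 2 / 8 := by nlinarith
  have hzero : ∀ (n : ℕ) (W : Submodule ℂ (J → ℂ)), Module.finrank ℂ W = 0 →
      degenerateSamples g W (Fin n) = ∅ := by
    intro n W h
    rw [Submodule.finrank_eq_zero] at h
    ext x
    simp only [degenerateSamples, h, Submodule.mem_bot, Set.mem_ofPred_eq, Set.mem_empty_iff_false,
      iff_false]
    rintro ⟨c, h0, h1, -⟩
    exact h1 h0
  induction n generalizing W with
  | zero =>
    rcases Nat.eq_zero_or_pos (Module.finrank ℂ W) with h | h
    · simp [hzero 0 W h]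
    -- With no samples the trivial bound 1 suffices, as the potential of a nonzero space is at least
    -- 1; this is why it jumps at dimension 0.
    · refine prob_le_one.trans ?_
      rw [← ENNReal.ofReal_one]
      apply ENNReal.ofReal_le_ofReal
      simp only [pow_zero, one_mul, dropPotential, h.ne', if_false]
      have : 0 ≤ t * √(Module.finrank ℂ W) := by positivity
      linarith
  | succ n ih =>
    rcases Nat.eq_zero_or_pos (Module.finrank ℂ W) with h | h
    · simp [hzero (n + 1) W h]
    set m := Module.finrank ℂ W with hm
    set A := nonvanishing g W with hA
    have hAm : MeasurableSet A := measurableSet_nonvanishing hg W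
    have hmp := measurePreserving_piFinSuccAbove (fun _ : Fin (n + 1) => μ) 0
    set e := MeasurableEquiv.piFinSuccAbove (fun _ : Fin (n + 1) => 𝓧) 0 with he
    set D := degenerateSamples g W (Fin (n + 1)) with hD
    have hDm : MeasurableSet D := measurableSet_degenerateSamples hg W _
    set D' : Set (𝓧 × (Fin n → 𝓧)) := e.symm ⁻¹' D with hD'
    have hD'm : MeasurableSet D' := e.symm.measurable hDm
    have hDD : D = e ⁻¹' D' := by
      ext x; simp [hD']
    have hslice : ∀ x : 𝓧, Prod.mk x ⁻¹' D' =
        degenerateSamples g (W ⊓ LinearMap.ker (evalAt g x)) (Fin n) := by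
      intro x
      ext y
      have : e.symm (x, y) = Fin.cons x y := by
        simp [he, MeasurableEquiv.piFinSuccAbove, Fin.insertNthEquiv]
      simp only [hD', Set.mem_preimage, this, hD, degenerateSamples, Set.mem_ofPred_eq,
        Submodule.mem_inf, LinearMap.mem_ker, evalAt_apply, Fin.forall_fin_succ, Fin.cons_zero,
        Fin.cons_succ]
      constructor
      · rintro ⟨c, h1, h2, h3, h4⟩; exact ⟨c, ⟨h1, h3⟩, h2, h4⟩
      · rintro ⟨c, ⟨h1, h3⟩, h2, h4⟩; exact ⟨c, h1, h2, h3, h4⟩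
    rw [hDD, hmp.measure_preimage hD'm.nullMeasurableSet, Measure.prod_apply hD'm]
    set a := (1 - t ^ 2 / 8) ^ n * dropPotential t (m - 1) with ha
    set b := (1 - t ^ 2 / 8) ^ n * dropPotential t m with hb
    have ha0 : 0 ≤ a := mul_nonneg (pow_nonneg hκ _) (dropPotential_nonneg ht.le _)
    have hb0 : 0 ≤ b := mul_nonneg (pow_nonneg hκ _) (dropPotential_nonneg ht.le _)
    have hp1 : μ.real A ≤ 1 := measureReal_le_one
    calc ∫⁻ x, (Measure.pi fun _ : Fin n => μ) (Prod.mk x ⁻¹' D') ∂μ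
        ≤ ∫⁻ x, (A.indicator (fun _ => ENNReal.ofReal a) x +
            Aᶜ.indicator (fun _ => ENNReal.ofReal b) x) ∂μ := by
          refine lintegral_mono fun x => ?_
          rw [hslice x]
          refine (ih _).trans ?_
          by_cases hx : x ∈ A
          · rw [Set.indicator_of_mem hx, Set.indicator_of_notMem (by simpa using hx), add_zero]
            apply ENNReal.ofReal_le_ofReal
            apply mul_le_mul_of_nonneg_left _ (pow_nonneg hκ _)
            apply dropPotential_mono ht.le
            have hlt : W ⊓ LinearMap.ker (evalAt g x) < W := by
              refine lt_of_le_of_ne inf_le_left fun h => ?_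
              obtain ⟨c, hc, hne⟩ := hx
              rw [← h] at hc
              exact hne hc.2
            have := Submodule.finrank_lt_finrank_of_lt hlt
            omega
          · rw [Set.indicator_of_notMem hx, Set.indicator_of_mem (by simpa using hx), zero_add]
            apply ENNReal.ofReal_le_ofReal
            apply mul_le_mul_of_nonneg_left _ (pow_nonneg hκ _)
            exact dropPotential_mono ht.le (Submodule.finrank_mono inf_le_left)
      _ = ENNReal.ofReal (a * μ.real A + b * (1 - μ.real A)) := by
          rw [lintegral_add_left (measurable_const.indicator hAm), lintegral_indicator_const hAm,
            lintegral_indicator_const hAm.compl, ← probReal_compl_eq_one_sub hAm,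
            ENNReal.ofReal_add (by positivity) (by positivity), ENNReal.ofReal_mul ha0,
            ENNReal.ofReal_mul hb0, ofReal_measureReal, ofReal_measureReal]
      _ ≤ _ := by
          apply ENNReal.ofReal_le_ofReal
          have := dropPotential_step ht h (hW W) hp1
          have h2 := mul_le_mul_of_nonneg_left this (pow_nonneg hκ n)
          calc a * μ.real A + b * (1 - μ.real A) = (1 - t ^ 2 / 8) ^ n *
              (μ.real A * dropPotential t (m - 1) + (1 - μ.real A) * dropPotential t m) := by
                rw [ha, hb]; ring
            _ ≤ _ := h2
            _ = _ := by ring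

/-- The probability that `n` independent points do not determine the coefficients of a linear
combination of the functions `g j`. -/
lemma pi_degenerateSamples_top_le {Nm : (J → ℂ) → ℝ} (hg : ∀ j, Measurable (g j))
    (hb : ∀ c x, ‖lincomb g c x‖ ≤ Nm c) {t : ℝ} (ht : 0 < t)
    (hl : ∀ c, t * Nm c ≤ ∫ x, ‖lincomb g c x‖ ∂μ) (hpos : ∀ c, c ≠ 0 → 0 < Nm c)
    [Nonempty J] (n : ℕ) :
    t ≤ 1 ∧ (Measure.pi fun _ : Fin n => μ) (degenerateSamples g ⊤ (Fin n)) ≤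
      ENNReal.ofReal (2 * Real.exp (-(n * (t ^ 2 / 8)))) := by
  have hW := mul_sqrt_finrank_le_nonvanishing (μ := μ) hg hb ht hl hpos
  have hD : 0 < Module.finrank ℂ (⊤ : Submodule ℂ (J → ℂ)) := by
    rw [finrank_top, Module.finrank_fintype_fun_eq_card]; exact Fintype.card_pos
  have h1 : t * √(Module.finrank ℂ (⊤ : Submodule ℂ (J → ℂ))) ≤ 1 :=
    (hW ⊤).trans measureReal_le_one
  have ht1 : t ≤ 1 := by
    have : 1 ≤ √(Module.finrank ℂ (⊤ : Submodule ℂ (J → ℂ)) : ℝ) := by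
      rw [Real.one_le_sqrt]; exact_mod_cast hD
    nlinarith
  refine ⟨ht1, (pi_degenerateSamples_le hg ht hW ht1 n ⊤).trans ?_⟩
  apply ENNReal.ofReal_le_ofReal
  -- Since `t√D ≤ 1` for the full dimension `D`, the initial potential is at most 2 whatever `D` is.
  have hF : dropPotential t (Module.finrank ℂ (⊤ : Submodule ℂ (J → ℂ))) ≤ 2 := by
    rw [dropPotential, if_neg hD.ne']; linarith
  have hκ : 0 ≤ 1 - t ^ 2 / 8 := by nlinarith
  have hE : (1 - t ^ 2 / 8) ^ n ≤ Real.exp (-(n * (t ^ 2 / 8))) := by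
    rw [show -(n * (t ^ 2 / 8)) = n * (-(t ^ 2 / 8)) by ring, Real.exp_nat_mul]
    apply pow_le_pow_left₀ hκ
    have := Real.add_one_le_exp (-(t ^ 2 / 8))
    linarith
  calc _ ≤ Real.exp (-(n * (t ^ 2 / 8))) * 2 :=
        mul_le_mul hE hF (dropPotential_nonneg ht.le _) (Real.exp_pos _).le
    _ = _ := by ring

end

end MixedSampling

/-! ### Lattice sums, Hölder's inequality and the supremum bound. -/

namespace MixedSampling

/-- Away from the origin the terms are dominated by `‖k‖⁻ᵃ`, summable over a lattice of rank `d`. -/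
lemma summable_inv_one_add_norm_rpow (d : ℕ) {a : ℝ} (ha : (d : ℝ) < a) :
    Summable fun k : Fin d → ℤ => (1 + ‖k‖)⁻¹ ^ a := by
  have ha0 : 0 < a := lt_of_le_of_lt (by positivity) ha
  let b := Pi.basisFun ℝ (Fin d)
  let L : Submodule ℤ (Fin d → ℝ) := Submodule.span ℤ (Set.range b)
  have hrank : Module.finrank ℤ L = d := by
    rw [ZLattice.rank ℝ L]; simp
  have hs := ZLattice.summable_norm_rpow L (-a) (by rw [hrank]; linarith)
  have hmem : ∀ k : Fin d → ℤ, (fun i => (k i : ℝ)) ∈ L := fun k =>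
    (b.mem_span_iff_repr_mem ℤ _).2 fun i => ⟨k i, by simp [b]⟩
  let F : (Fin d → ℤ) → L := fun k => ⟨fun i => (k i : ℝ), hmem k⟩
  have hF : Function.Injective F := fun k k' h => by
    funext i
    have : (k i : ℝ) = k' i := congrFun (congrArg Subtype.val h) i
    exact_mod_cast this
  have hs2 := hs.comp_injective hF
  refine Summable.of_norm_bounded_eventually hs2 ?_
  rw [Filter.eventually_cofinite]
  refine (Set.finite_singleton (0 : Fin d → ℤ)).subset fun k hk => ?_
  by_contra hne
  apply hk
  have hn : ‖F k‖ = ‖k‖ := by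
    change ‖(fun i => (k i : ℝ))‖ = ‖k‖
    rw [Pi.norm_def, Pi.norm_def]
    congr 1
  have hpos : 0 < ‖k‖ := norm_pos_iff.2 hne
  rw [Function.comp_apply, hn, Real.norm_of_nonneg (by positivity), Real.rpow_neg hpos.le,
    ← Real.inv_rpow hpos.le]
  exact Real.rpow_le_rpow (by positivity) (inv_anti₀ hpos (by linarith)) ha0.le

lemma tsum_mul_le_Lp_mul_Lq {ι : Type*} {p q : ℝ} (hpq : p.HolderConjugate q) (f g : ι → ℝ≥0∞) :
    ∑' i, f i * g i ≤ (∑' i, f i ^ p) ^ (1 / p) * (∑' i, g i ^ q) ^ (1 / q) := by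
  let _ : MeasurableSpace ι := ⊤
  have hm : ∀ h : ι → ℝ≥0∞, Measurable h := fun h => measurable_from_top
  have := ENNReal.lintegral_mul_le_Lp_mul_Lq (Measure.count : Measure ι) hpq
    (hm f).aemeasurable (hm g).aemeasurable
  simpa [lintegral_count' (hm _)] using this

/-- Hölder's inequality for `l^{p,q}` against a product sequence. -/
lemma tsum_mul_prod_le {α κ : Type*} {p q : ℝ} (hp : 1 < p) (hq : 1 < q)
    (a : α → κ → ℝ≥0∞) (u : α → ℝ≥0∞) (w : κ → ℝ≥0∞) :
    ∑' i, ∑' j, a i j * (u i * w j) ≤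
      (∑' i, (∑' j, a i j ^ q) ^ (p / q)) ^ (1 / p) *
        ((∑' i, u i ^ (p / (p - 1))) ^ ((p - 1) / p) *
          (∑' j, w j ^ (q / (q - 1))) ^ ((q - 1) / q)) := by
  have hp' : p.HolderConjugate (p / (p - 1)) := Real.HolderConjugate.conjExponent hp
  have hq' : q.HolderConjugate (q / (q - 1)) := Real.HolderConjugate.conjExponent hq
  set W := (∑' j, w j ^ (q / (q - 1))) ^ ((q - 1) / q) with hW
  have h1 : ∀ i, ∑' j, a i j * (u i * w j) ≤ (∑' j, a i j ^ q) ^ (1 / q) * u i * W := fun i => by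
    calc ∑' j, a i j * (u i * w j) = u i * ∑' j, a i j * w j := by
          rw [← ENNReal.tsum_mul_left]; exact tsum_congr fun j => by ring
      _ ≤ u i * ((∑' j, a i j ^ q) ^ (1 / q) * W) := by
          gcongr
          have := tsum_mul_le_Lp_mul_Lq hq' (a i) w
          rwa [one_div_div] at this
      _ = _ := by ring
  calc ∑' i, ∑' j, a i j * (u i * w j) ≤ ∑' i, (∑' j, a i j ^ q) ^ (1 / q) * u i * W :=
        ENNReal.tsum_le_tsum h1
    _ = (∑' i, (∑' j, a i j ^ q) ^ (1 / q) * u i) * W := by rw [ENNReal.tsum_mul_right]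
    _ ≤ ((∑' i, ((∑' j, a i j ^ q) ^ (1 / q)) ^ p) ^ (1 / p) *
          (∑' i, u i ^ (p / (p - 1))) ^ ((p - 1) / p)) * W := by
        gcongr
        have := tsum_mul_le_Lp_mul_Lq hp' (fun i => (∑' j, a i j ^ q) ^ (1 / q)) u
        rwa [one_div_div] at this
    _ = _ := by
        rw [mul_assoc]
        congr 2
        refine tsum_congr fun i => ?_
        rw [← ENNReal.rpow_mul]; congr 1; ring

lemma norm_sub_latticePt_snd {d : ℕ} (y : EuclideanSpace ℝ (Fin d)) (k : Idx d) :
    ‖y - (latticePt k).2‖ = √(∑ i, (y i - k.2 i) ^ 2) := by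
  simp [EuclideanSpace.norm_eq, latticePt]

lemma inv_rpow_rpow_conj {x s p : ℝ} (hx : 0 < x) :
    ENNReal.ofReal (x⁻¹ ^ s) ^ (p / (p - 1)) = ENNReal.ofReal (x⁻¹ ^ (s * p / (p - 1))) := by
  have : 0 < x⁻¹ := inv_pos.2 hx
  rw [ENNReal.ofReal_rpow_of_pos (by positivity), ← Real.rpow_mul this.le, mul_div_assoc]

/-- The product of the two lattice sums in the constant `c^*`. -/
def latticeConst (d : ℕ) (p q s₁ s₂ : ℝ) : ℝ :=
  (∑' k₁ : ℤ, 1 / (1 + |(k₁ : ℝ)|) ^ (s₁ * p / (p - 1))) ^ ((p - 1) / p)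
    * (∑' k₂ : Fin d → ℤ, 1 / (1 + ‖k₂‖) ^ (s₂ * q / (q - 1))) ^ ((q - 1) / q)

lemma one_div_rpow_eq {x s : ℝ} (hx : 0 ≤ x) : 1 / x ^ s = x⁻¹ ^ s := by
  rw [Real.inv_rpow hx, one_div]

lemma summable_inv_one_add_abs_rpow {a : ℝ} (ha : 1 < a) :
    Summable fun k : ℤ => (1 + |(k : ℝ)|)⁻¹ ^ a := by
  have := summable_inv_one_add_norm_rpow 1 (a := a) (by simpa using ha)
  have h2 := (Equiv.summable_iff (Equiv.funUnique (Fin 1) ℤ).symm).2 this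
  refine h2.congr fun k => ?_
  have : ‖(Equiv.funUnique (Fin 1) ℤ).symm k‖ = |(k : ℝ)| := by
    have h : (Equiv.funUnique (Fin 1) ℤ).symm k = fun _ => k := rfl
    rw [h, pi_norm_const, Int.norm_eq_abs]
  rw [Function.comp_apply, this]

lemma tsum_translate_int_le (x : ℝ) {a : ℝ} (ha : 1 ≤ a) :
    ∑' k : ℤ, ENNReal.ofReal ((1 + |x - k|)⁻¹ ^ a) ≤
      ∑' k : ℤ, ENNReal.ofReal ((1 + |(k : ℝ)|)⁻¹ ^ a) := by
  have := tsum_translate_le (ι := Fin 1) (fun _ => x) (a := a) (by simpa using ha)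
  rw [← (Equiv.funUnique (Fin 1) ℤ).symm.tsum_eq, ← (Equiv.funUnique (Fin 1) ℤ).symm.tsum_eq]
    at this
  have h : ∀ k, (Equiv.funUnique (Fin 1) ℤ).symm k = fun _ => k := fun _ => rfl
  simpa [h, pi_norm_const, Int.norm_eq_abs, Real.sqrt_sq_eq_abs] using this

variable {d r : ℕ}

/-- Mixed Hölder separates the coefficients from the product weight; each of the two lattice sums is
then freed of its dependence on `z` by the translation comparison. -/
lemma enorm_tsum_lattice_le (hd : 0 < d) {p q : ℝ} (hp : 1 < p) (hq : 1 < q) {s₁ s₂ : ℝ}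
    (hs₁ : (d : ℝ) + 1 - 1 / p - d / q < s₁) (hs₂ : (d : ℝ) + 1 - 1 / p - d / q < s₂)
    (c : Idx d → ℂ) (z : Dom d) :
    ∑' k₁ : ℤ, ∑' k₂ : Fin d → ℤ, ‖c (k₁, k₂)‖ₑ *
      (ENNReal.ofReal ((1 + |z.1 - k₁|)⁻¹ ^ s₁) *
        ENNReal.ofReal ((1 + √(∑ i, (z.2 i - k₂ i) ^ 2))⁻¹ ^ s₂)) ≤
      seqNorm p q c * ENNReal.ofReal (latticeConst d p q s₁ s₂) := by
  have hd1 : (1 : ℝ) ≤ d := by exact_mod_cast hd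
  have hp0 : 0 < p := by linarith
  have hq0 : 0 < q := by linarith
  -- The decay threshold is `(p-1)/p + d(q-1)/q`. Either summand alone gives the exponent condition
  -- for one of the sums, at the conjugate exponents.
  have e1 : 1 - 1 / p = (p - 1) / p := by field_simp
  have e2 : (d : ℝ) - d / q = d * ((q - 1) / q) := by field_simp
  have hpp : 0 < (p - 1) / p := div_pos (by linarith) hp0
  have hqq : 0 < (q - 1) / q := div_pos (by linarith) hq0
  have h1 : 1 < s₁ * p / (p - 1) := by
    rw [lt_div_iff₀ (by linarith), one_mul]
    have : (p - 1) / p < s₁ := by nlinarith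
    rwa [div_lt_iff₀ hp0] at this
  have h2 : (d : ℝ) < s₂ * q / (q - 1) := by
    rw [lt_div_iff₀ (by linarith)]
    have : d * ((q - 1) / q) < s₂ := by linarith
    rwa [← mul_div_assoc, div_lt_iff₀ hq0] at this
  refine (tsum_mul_prod_le hp hq (fun k₁ k₂ => ‖c (k₁, k₂)‖ₑ) _ _).trans ?_
  unfold seqNorm
  gcongr
  unfold latticeConst
  have hS1 : ∑' k : ℤ, ENNReal.ofReal ((1 + |(k : ℝ)|)⁻¹ ^ (s₁ * p / (p - 1))) =
      ENNReal.ofReal (∑' k₁ : ℤ, 1 / (1 + |(k₁ : ℝ)|) ^ (s₁ * p / (p - 1))) := by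
    rw [ENNReal.ofReal_tsum_of_nonneg (fun k => by positivity)]
    · exact tsum_congr fun k => by rw [one_div_rpow_eq (by positivity)]
    · exact (summable_inv_one_add_abs_rpow h1).congr fun k => (one_div_rpow_eq (by positivity)).symm
  have hS2 : ∑' k : Fin d → ℤ, ENNReal.ofReal ((1 + ‖k‖)⁻¹ ^ (s₂ * q / (q - 1))) =
      ENNReal.ofReal (∑' k : Fin d → ℤ, 1 / (1 + ‖k‖) ^ (s₂ * q / (q - 1))) := by
    rw [ENNReal.ofReal_tsum_of_nonneg (fun k => by positivity)]
    · exact tsum_congr fun k => by rw [one_div_rpow_eq (by positivity)]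
    · exact (summable_inv_one_add_norm_rpow d h2).congr fun k =>
        (one_div_rpow_eq (by positivity)).symm
  have n1 : 0 ≤ ∑' k₁ : ℤ, 1 / (1 + |(k₁ : ℝ)|) ^ (s₁ * p / (p - 1)) :=
    tsum_nonneg fun k => by positivity
  have n2 : 0 ≤ ∑' k : Fin d → ℤ, 1 / (1 + ‖k‖) ^ (s₂ * q / (q - 1)) :=
    tsum_nonneg fun k => by positivity
  rw [ENNReal.ofReal_mul (by positivity), ← ENNReal.ofReal_rpow_of_nonneg n1 hpp.le,
    ← ENNReal.ofReal_rpow_of_nonneg n2 hqq.le, ← hS1, ← hS2]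
  have : Nonempty (Fin d) := ⟨⟨0, hd⟩⟩
  refine mul_le_mul' (ENNReal.rpow_le_rpow ?_ hpp.le) (ENNReal.rpow_le_rpow ?_ hqq.le)
  · refine le_trans (le_of_eq ?_) (tsum_translate_int_le z.1 h1.le)
    exact tsum_congr fun k => inv_rpow_rpow_conj (by positivity)
  · refine le_trans (le_of_eq ?_) (tsum_translate_le (fun i => z.2 i) (by simpa using h2.le))
    exact tsum_congr fun k => inv_rpow_rpow_conj (by positivity)

variable {p q : ℝ} {φ : Fin r → Dom d → ℂ} {α₁ α₂ ctil s₁ s₂ : ℝ}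

lemma GeneratorAssumption.enorm_translate_le (h : GeneratorAssumption p q φ α₁ α₂ ctil s₁ s₂)
    (i : Fin r) (z : Dom d) (k : Idx d) :
    ‖φ i (z - latticePt k)‖ₑ ≤ ENNReal.ofReal ctil *
      (ENNReal.ofReal ((1 + |z.1 - k.1|)⁻¹ ^ s₁) *
        ENNReal.ofReal ((1 + √(∑ j, (z.2 j - k.2 j) ^ 2))⁻¹ ^ s₂)) := by
  rw [← ENNReal.ofReal_mul (by positivity), ← ENNReal.ofReal_mul h.ctil_pos.le,
    ← ofReal_norm]
  apply ENNReal.ofReal_le_ofReal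
  refine (h.decay i _).trans (le_of_eq ?_)
  rw [Prod.snd_sub, norm_sub_latticePt_snd, ← one_div_rpow_eq (by positivity),
    ← one_div_rpow_eq (by positivity)]
  have : (z - latticePt k).1 = z.1 - k.1 := rfl
  rw [this]
  field_simp

lemma GeneratorAssumption.enorm_finSynth_le (h : GeneratorAssumption p q φ α₁ α₂ ctil s₁ s₂)
    (hd : 0 < d) (hp : 1 < p) (hq : 1 < q) (N : ℕ) (c : Fin r → Idx d → ℂ) (z : Dom d) :
    ‖finSynth N φ c z‖ₑ ≤
      ENNReal.ofReal (ctil * latticeConst d p q s₁ s₂) * vecSeqNorm p q c := by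
  set w : Idx d → ℝ≥0∞ := fun k => ENNReal.ofReal ((1 + |z.1 - k.1|)⁻¹ ^ s₁) *
        ENNReal.ofReal ((1 + √(∑ j, (z.2 j - k.2 j) ^ 2))⁻¹ ^ s₂) with hw
  calc ‖finSynth N φ c z‖ₑ ≤ ∑ k ∈ box d N, ∑ i, ‖c i k‖ₑ * (ENNReal.ofReal ctil * w k) := by
        refine (enorm_sum_le _ _).trans (Finset.sum_le_sum fun k _ => ?_)
        refine (enorm_sum_le _ _).trans (Finset.sum_le_sum fun i _ => ?_)
        rw [enorm_mul]
        gcongr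
        exact h.enorm_translate_le i z k
    _ = ENNReal.ofReal ctil * ∑ i, ∑ k ∈ box d N, ‖c i k‖ₑ * w k := by
        rw [Finset.sum_comm, Finset.mul_sum]
        refine Finset.sum_congr rfl fun i _ => ?_
        rw [Finset.mul_sum]
        exact Finset.sum_congr rfl fun k _ => by ring
    _ ≤ ENNReal.ofReal ctil * ∑ i, seqNorm p q (c i) *
          ENNReal.ofReal (latticeConst d p q s₁ s₂) := by
        gcongr with i
        refine (ENNReal.sum_le_tsum _).trans ?_
        rw [ENNReal.tsum_prod']
        exact enorm_tsum_lattice_le hd hp hq h.s₁_gt h.s₂_gt (c i) z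
    _ = _ := by
        rw [← Finset.sum_mul, vecSeqNorm, ENNReal.ofReal_mul h.ctil_pos.le]
        ring

/-- Testing the preceding bound on a unit sequence at `z = 0` excludes the value 0. -/
lemma latticeConst_pos (hd : 0 < d) (hp : 1 < p) (hq : 1 < q)
    (hs₁ : (d : ℝ) + 1 - 1 / p - d / q < s₁) (hs₂ : (d : ℝ) + 1 - 1 / p - d / q < s₂) :
    0 < latticeConst d p q s₁ s₂ := by
  have hb := enorm_tsum_lattice_le hd hp hq hs₁ hs₂ (fun k : Idx d => if k = 0 then 1 else 0) 0
  by_contra hneg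
  rw [ENNReal.ofReal_of_nonpos (not_lt.1 hneg), mul_zero, nonpos_iff_eq_zero,
    ENNReal.tsum_eq_zero] at hb
  have h0 := ENNReal.tsum_eq_zero.1 (hb 0) 0
  have : ((0 : ℤ), (0 : Fin d → ℤ)) = 0 := rfl
  simp [this] at h0

/-- The surplus factor in `cStar` is `4 / 2^{1/p + 1/q}`, at least 1 because `1/p + 1/q ≤ 2`. -/
lemma mul_latticeConst_le_cStar (hd : 0 < d) (hp : 1 < p) (hq : 1 < q)
    (h : GeneratorAssumption p q φ α₁ α₂ ctil s₁ s₂) :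
    ctil * latticeConst d p q s₁ s₂ ≤ α₁ * cStar d p q α₁ ctil s₁ s₂ := by
  have hL := latticeConst_pos hd hp hq h.s₁_gt h.s₂_gt
  have h1 := h.α₁_pos
  have hexp : (2 : ℝ) ^ ((p + q) / (p * q)) ≤ 4 := by
    have : (p + q) / (p * q) ≤ 2 := by
      rw [div_le_iff₀ (by nlinarith)]; nlinarith
    calc (2 : ℝ) ^ ((p + q) / (p * q)) ≤ 2 ^ (2 : ℝ) :=
          Real.rpow_le_rpow_of_exponent_le (by norm_num) this
      _ = 4 := by norm_num
  have hE : 0 < (2 : ℝ) ^ ((p + q) / (p * q)) := by positivity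
  have : α₁ * cStar d p q α₁ ctil s₁ s₂ =
      4 / (2 : ℝ) ^ ((p + q) / (p * q)) * (ctil * latticeConst d p q s₁ s₂) := by
    unfold cStar latticeConst
    field_simp
  rw [this]
  have h2 := mul_pos h.ctil_pos hL
  have h3 : 1 ≤ 4 / (2 : ℝ) ^ ((p + q) / (p * q)) := (one_le_div hE).2 hexp
  nlinarith

lemma cStar_pos (hd : 0 < d) (hp : 1 < p) (hq : 1 < q)
    (h : GeneratorAssumption p q φ α₁ α₂ ctil s₁ s₂) : 0 < cStar d p q α₁ ctil s₁ s₂ := by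
  have h1 := mul_latticeConst_le_cStar hd hp hq h
  have h2 := mul_pos h.ctil_pos (latticeConst_pos hd hp hq h.s₁_gt h.s₂_gt)
  exact pos_of_mul_pos_right (h2.trans_le h1) h.α₁_pos.le

end MixedSampling

/-! ### Sequence norms, convolution and comparison of norms on the cuboid. -/

namespace MixedSampling

variable {d r : ℕ} {p q : ℝ}

section SequenceNorms

lemma seqNorm_lt_top {N : ℕ} (hp : 0 < p) (hq : 0 < q) {c : Idx d → ℂ}
    (hc : ∀ k, k ∉ box d N → c k = 0) : seqNorm p q c < ∞ := by
  have hmem : ∀ k₁ k₂, (k₁, k₂) ∈ box d N ↔ k₁ ∈ Finset.Icc (-(N : ℤ)) N ∧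
      k₂ ∈ Fintype.piFinset fun _ => Finset.Icc (-(N : ℤ)) N := fun k₁ k₂ => Finset.mem_product
  unfold seqNorm
  apply ENNReal.rpow_lt_top_of_nonneg (by positivity)
  rw [tsum_eq_sum (s := Finset.Icc (-(N : ℤ)) N)]
  · refine (ENNReal.sum_lt_top.2 fun k₁ _ => ENNReal.rpow_lt_top_of_nonneg (by positivity) ?_).ne
    rw [tsum_eq_sum (s := Fintype.piFinset fun _ => Finset.Icc (-(N : ℤ)) N)]
    · exact (ENNReal.sum_lt_top.2 fun k₂ _ =>
        ENNReal.rpow_lt_top_of_nonneg hq.le enorm_ne_top).ne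
    · intro k₂ hk₂
      rw [hc _ fun h => hk₂ ((hmem _ _).1 h).2]
      simp [hq]
  · intro k₁ hk₁
    have : ∀ k₂, ‖c (k₁, k₂)‖ₑ ^ q = 0 := fun k₂ => by
      rw [hc _ fun h => hk₁ ((hmem _ _).1 h).1]; simp [hq]
    simp [this, div_pos hp hq]

lemma eq_zero_of_seqNorm_eq_zero (hp : 0 < p) (hq : 0 < q) {c : Idx d → ℂ}
    (h : seqNorm p q c = 0) : c = 0 := by
  funext ⟨k₁, k₂⟩
  unfold seqNorm at h
  rw [ENNReal.rpow_eq_zero_iff_of_pos (by positivity), ENNReal.tsum_eq_zero] at h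
  have h1 := h k₁
  rw [ENNReal.rpow_eq_zero_iff_of_pos (by positivity), ENNReal.tsum_eq_zero] at h1
  have h2 := h1 k₂
  rw [ENNReal.rpow_eq_zero_iff_of_pos hq] at h2
  simpa using h2

lemma vecSeqNorm_lt_top {N : ℕ} (hp : 0 < p) (hq : 0 < q) {c : Fin r → Idx d → ℂ}
    (hc : ∀ i k, k ∉ box d N → c i k = 0) : vecSeqNorm p q c < ∞ :=
  ENNReal.sum_lt_top.2 fun i _ => seqNorm_lt_top hp hq (hc i)

lemma eq_zero_of_vecSeqNorm_eq_zero (hp : 0 < p) (hq : 0 < q) {c : Fin r → Idx d → ℂ}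
    (h : vecSeqNorm p q c = 0) : c = 0 := by
  funext i
  exact eq_zero_of_seqNorm_eq_zero hp hq (Finset.sum_eq_zero_iff.1 h i (Finset.mem_univ i))

/-- A nonzero coefficient sequence supported at the origin. -/
def deltaSeq (d r : ℕ) : Fin r → Idx d → ℂ := fun _ k => if k = 0 then 1 else 0

lemma zero_mem_box (d N : ℕ) : (0 : Idx d) ∈ box d N := by
  simp [box]

lemma deltaSeq_support (N : ℕ) (i : Fin r) (k : Idx d) (hk : k ∉ box d N) :
    deltaSeq d r i k = 0 :=
  if_neg fun h => hk (by rw [h]; exact zero_mem_box d N)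

lemma vecSeqNorm_deltaSeq_ne_zero (hr : 0 < r) (hp : 0 < p) (hq : 0 < q) :
    vecSeqNorm p q (deltaSeq d r) ≠ 0 := fun h => by
  have := congrFun (congrFun (eq_zero_of_vecSeqNorm_eq_zero hp hq h) ⟨0, hr⟩) 0
  simp [deltaSeq] at this

lemma GeneratorAssumption.α₁_le_α₂ {φ : Fin r → Dom d → ℂ} {α₁ α₂ ctil s₁ s₂ : ℝ}
    (h : GeneratorAssumption p q φ α₁ α₂ ctil s₁ s₂) (hr : 0 < r) (hp : 0 < p) (hq : 0 < q) :
    α₁ ≤ α₂ := by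
  have h1 := h.stable (deltaSeq d r) fun i => seqNorm_lt_top (N := 0) hp hq (deltaSeq_support 0 i)
  have h2 := h1.1.trans h1.2
  rw [ENNReal.mul_le_mul_iff_left (vecSeqNorm_deltaSeq_ne_zero hr hp hq)
    (vecSeqNorm_lt_top (N := 0) hp hq (deltaSeq_support 0)).ne] at h2
  exact (ENNReal.ofReal_le_ofReal_iff h.α₂_pos.le).1 h2

end SequenceNorms

section Convolution

instance isAddHaarMeasure_volume_dom (d : ℕ) :
    (volume : Measure (Dom d)).IsAddHaarMeasure :=
  inferInstanceAs ((volume : Measure ℝ).prod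
    (volume : Measure (EuclideanSpace ℝ (Fin d)))).IsAddHaarMeasure

lemma conv_apply (f ψ : Dom d → ℂ) (z : Dom d) : conv f ψ z = ∫ t, f t * ψ (z - t) := rfl

lemma norm_conv_le {f ψ : Dom d → ℂ} {S : ℝ} (hf : ∀ z, ‖f z‖ ≤ S) (hψ : Integrable ψ)
    (z : Dom d) : ‖conv f ψ z‖ ≤ S * ∫ t, ‖ψ t‖ := by
  rw [conv_apply, ← integral_sub_left_eq_self (fun t => ‖ψ t‖) volume z, ← integral_const_mul]
  refine norm_integral_le_of_norm_le ((hψ.norm.comp_sub_left z).const_mul S)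
    (Filter.Eventually.of_forall fun t => ?_)
  rw [norm_mul]
  exact mul_le_mul_of_nonneg_right (hf t) (norm_nonneg _)

lemma continuous_conv {f ψ : Dom d → ℂ} {S : ℝ} (hf : ∀ z, ‖f z‖ ≤ S) (hc : Continuous f)
    (hψ : Integrable ψ) : Continuous (conv f ψ) :=
  BddAbove.continuous_convolution_left_of_integrable _
    ⟨S, by rintro _ ⟨z, rfl⟩; exact hf z⟩ hc hψ

lemma conv_translate (f ψ : Dom d → ℂ) (w z : Dom d) :
    conv (fun t => f (t - w)) ψ z = conv f ψ (z - w) := by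
  rw [conv_apply, conv_apply,
    ← integral_sub_right_eq_self (fun t => f t * ψ (z - w - t)) w]
  congr 1; funext t; congr 2; abel

lemma conv_finSynth {φ : Fin r → Dom d → ℂ} {ψ : Dom d → ℂ} {S : ℝ} (hφ : ∀ i z, ‖φ i z‖ ≤ S)
    (hc : ∀ i, Continuous (φ i)) (hψ : Integrable ψ) (N : ℕ) (c : Fin r → Idx d → ℂ) :
    conv (finSynth N φ c) ψ = finSynth N (fun i => conv (φ i) ψ) c := by
  funext z
  have hint : ∀ i k, Integrable fun t => c i k * φ i (t - latticePt k) * ψ (z - t) := by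
    intro i k
    refine (hψ.comp_sub_left z).bdd_mul (c := ‖c i k‖ * S) ?_ (Filter.Eventually.of_forall ?_)
    · exact (continuous_const.mul ((hc i).comp (continuous_id.sub continuous_const))
        ).aestronglyMeasurable
    · intro t
      rw [norm_mul]
      exact mul_le_mul_of_nonneg_left (hφ i _) (norm_nonneg _)
  rw [conv_apply]
  simp only [finSynth, Finset.sum_mul]
  rw [integral_finsetSum _ fun k _ => integrable_finsetSum _ fun i _ => hint i k]
  refine Finset.sum_congr rfl fun k _ => ?_
  rw [integral_finsetSum _ fun i _ => hint i k]
  refine Finset.sum_congr rfl fun i _ => ?_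
  rw [← conv_translate, conv_apply, ← integral_const_mul]
  exact integral_congr_ae (Filter.Eventually.of_forall fun t => by simp only; ring)

lemma GeneratorAssumption.norm_le {φ : Fin r → Dom d → ℂ} {α₁ α₂ ctil s₁ s₂ : ℝ}
    (h : GeneratorAssumption p q φ α₁ α₂ ctil s₁ s₂) (i : Fin r) (z : Dom d) :
    ‖φ i z‖ ≤ ctil := by
  refine (h.decay i z).trans (div_le_self h.ctil_pos.le ?_)
  have h1 : (1 : ℝ) ≤ (1 + |z.1|) ^ s₁ :=
    Real.one_le_rpow (by linarith [abs_nonneg z.1]) h.s₁_pos.le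
  have h2 : (1 : ℝ) ≤ (1 + ‖z.2‖) ^ s₂ :=
    Real.one_le_rpow (by linarith [norm_nonneg z.2]) h.s₂_pos.le
  nlinarith

lemma AveragingAssumption.integral_norm_eq {K₁ K₂ : ℝ} {ψ : Dom d → ℂ}
    (h : AveragingAssumption K₁ K₂ ψ) : ∫ z, ‖ψ z‖ = l1Norm K₁ K₂ ψ := by
  unfold l1Norm
  rw [setIntegral_eq_integral_of_ae_compl_eq_zero]
  filter_upwards [h.supp] with z hz hzc
  rw [hz hzc, norm_zero]

end Convolution

section Domain

lemma measurableSet_cube (d : ℕ) (K : ℝ) : MeasurableSet (cube d K) := by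
  have : cube d K = ⋂ i, (fun y : EuclideanSpace ℝ (Fin d) => y i) ⁻¹' Set.Icc (-K) K := by
    ext y; simp [cube]
  rw [this]
  exact MeasurableSet.iInter fun i => (by fun_prop : Measurable
    fun y : EuclideanSpace ℝ (Fin d) => y i) measurableSet_Icc

lemma volume_cube (d : ℕ) {K : ℝ} (hK : 0 ≤ K) :
    volume (cube d K) = ENNReal.ofReal ((2 * K) ^ (d : ℝ)) := by
  have h1 : cube d K = (WithLp.ofLp : EuclideanSpace ℝ (Fin d) → Fin d → ℝ) ⁻¹'
      Set.pi Set.univ fun _ => Set.Icc (-K) K := by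
    ext y; simp only [cube, Set.mem_preimage, Set.mem_univ_pi, Set.mem_ofPred_eq]
  rw [h1, (PiLp.volume_preserving_ofLp (Fin d)).measure_preimage
    (MeasurableSet.univ_pi fun _ => measurableSet_Icc).nullMeasurableSet, volume_pi_pi]
  simp only [Real.volume_Icc, Finset.prod_const, Finset.card_univ, Fintype.card_fin]
  rw [← ENNReal.ofReal_pow (by linarith), Real.rpow_natCast]
  congr 2; ring

lemma measurableSet_cuboid (d : ℕ) (K₁ K₂ : ℝ) : MeasurableSet (cuboid d K₁ K₂) :=
  measurableSet_Icc.prod (measurableSet_cube d K₂)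

lemma lintegral_cuboid {K₁ K₂ : ℝ} {F : Dom d → ℝ≥0∞} (hF : Measurable F) :
    ∫⁻ z in cuboid d K₁ K₂, F z =
      ∫⁻ x in Set.Icc (-K₁) K₁, ∫⁻ y in cube d K₂, F (x, y) := by
  unfold cuboid
  rw [Measure.volume_eq_prod, ← Measure.prod_restrict, lintegral_prod _ hF.aemeasurable]

end Domain

/-- Hölder's inequality against the constant function 1. -/
lemma lintegral_rpow_le {α : Type*} [MeasurableSpace α] {μ : Measure α} {f : α → ℝ≥0∞}
    (hf : AEMeasurable f μ) {s : ℝ} (hs : 1 < s) :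
    (∫⁻ x, f x ∂μ) ^ s ≤ μ Set.univ ^ (s - 1) * ∫⁻ x, f x ^ s ∂μ := by
  have h := ENNReal.lintegral_mul_le_Lp_mul_Lq μ (Real.HolderConjugate.conjExponent hs) hf
    (aemeasurable_const (b := (1 : ℝ≥0∞)))
  simp only [Pi.mul_apply, mul_one, ENNReal.one_rpow, lintegral_const, one_mul] at h
  have h2 := ENNReal.rpow_le_rpow h (by linarith : 0 ≤ s)
  refine h2.trans (le_of_eq ?_)
  rw [ENNReal.mul_rpow_of_nonneg _ _ (by linarith), ← ENNReal.rpow_mul, ← ENNReal.rpow_mul,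
    one_div, inv_mul_cancel₀ (by linarith), ENNReal.rpow_one, mul_comm]
  congr 2
  rw [Real.conjExponent]
  have : s ≠ 0 := by linarith
  have : s - 1 ≠ 0 := by linarith
  field_simp

/-- Comparison of the `L^{p,q}` and `L¹` norms of a bounded function on the cuboid. -/
lemma mixedNormCuboid_rpow_le {K₁ K₂ : ℝ} (hK₁ : 0 < K₁) (hK₂ : 0 < K₂) (hp : 1 < p) (hq : 1 < q)
    {g : Dom d → ℂ} (hg : Measurable g) {M : ℝ} (hM : 0 < M) (hb : ∀ z, ‖g z‖ ≤ M) :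
    mixedNormCuboid p q K₁ K₂ g ^ (p * q) ≤
      ENNReal.ofReal ((2 * K₁) ^ (q - 1) * (2 * K₂) ^ (d * (p - 1)) * M ^ (p * q - 1)) *
        ∫⁻ z in cuboid d K₁ K₂, ‖g z‖ₑ := by
  have hp0 : 0 < p := by linarith
  have hq0 : 0 < q := by linarith
  set m : ℝ≥0∞ := ENNReal.ofReal M with hm
  have hgm : ∀ z, ‖g z‖ₑ ≤ m := fun z => by
    rw [← ofReal_norm]; exact ENNReal.ofReal_le_ofReal (hb z)
  set h : ℝ → ℝ≥0∞ := fun x => ∫⁻ y in cube d K₂, ‖g (x, y)‖ₑ with hh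
  have hgn : Measurable fun z => ‖g z‖ₑ := hg.enorm
  have hhm : Measurable h := Measurable.lintegral_prod_right' (f := fun z => ‖g z‖ₑ) hgn
  set V : ℝ≥0∞ := volume (cube d K₂) with hV
  have hle : ∀ x, h x ≤ m * V := fun x => by
    calc h x ≤ ∫⁻ y in cube d K₂, m := lintegral_mono fun y => hgm _
      _ = m * V := by simp [hV]
  -- All but one power of `‖g‖` is replaced by its bound; `hpow` does the same for the inner
  -- integral `h`, leaving a single `L¹` factor. The outer power `q` is moved inside by Hölder on
  -- the interval.
  have hinner : ∀ x, (∫⁻ y in cube d K₂, ‖g (x, y)‖ₑ ^ q) ^ (p / q) ≤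
      (m ^ (q - 1) * h x) ^ (p / q) := fun x => by
    apply ENNReal.rpow_le_rpow _ (by positivity)
    have hgx : Measurable fun y => ‖g (x, y)‖ₑ := hgn.comp measurable_prodMk_left
    simp only [hh]
    rw [← lintegral_const_mul _ hgx]
    refine lintegral_mono fun y => ?_
    have : ‖g (x, y)‖ₑ ^ q = ‖g (x, y)‖ₑ ^ (q - 1) * ‖g (x, y)‖ₑ := by
      nth_rw 3 [← ENNReal.rpow_one ‖g (x, y)‖ₑ]
      rw [← ENNReal.rpow_add_of_nonneg _ _ (by linarith) zero_le_one, sub_add_cancel]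
    rw [this]
    gcongr
    exact hgm _
  have hpow : ∀ x, ((m ^ (q - 1) * h x) ^ (p / q)) ^ q ≤
      m ^ ((q - 1) * p) * (m * V) ^ (p - 1) * h x := fun x => by
    rw [← ENNReal.rpow_mul, div_mul_cancel₀ _ hq0.ne', ENNReal.mul_rpow_of_nonneg _ _ hp0.le,
      ← ENNReal.rpow_mul, mul_assoc]
    gcongr
    have : h x ^ p = h x ^ (p - 1) * h x := by
      nth_rw 3 [← ENNReal.rpow_one (h x)]
      rw [← ENNReal.rpow_add_of_nonneg _ _ (by linarith) zero_le_one, sub_add_cancel]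
    rw [this]
    gcongr
    exact hle x
  have hA : (volume.restrict (Set.Icc (-K₁) K₁)) Set.univ = ENNReal.ofReal (2 * K₁) := by
    rw [Measure.restrict_apply_univ, Real.volume_Icc]; congr 1; ring
  unfold mixedNormCuboid mixedNormOn
  rw [← ENNReal.rpow_mul, show 1 / p * (p * q) = q by field_simp]
  calc (∫⁻ x in Set.Icc (-K₁) K₁, (∫⁻ y in cube d K₂, ‖g (x, y)‖ₑ ^ q) ^ (p / q)) ^ q
      ≤ (∫⁻ x in Set.Icc (-K₁) K₁, (m ^ (q - 1) * h x) ^ (p / q)) ^ q :=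
        ENNReal.rpow_le_rpow (lintegral_mono hinner) hq0.le
    _ ≤ ENNReal.ofReal (2 * K₁) ^ (q - 1) *
          ∫⁻ x in Set.Icc (-K₁) K₁, ((m ^ (q - 1) * h x) ^ (p / q)) ^ q := by
        rw [← hA]
        exact lintegral_rpow_le ((hhm.const_mul _).pow_const _).aemeasurable hq
    _ ≤ ENNReal.ofReal (2 * K₁) ^ (q - 1) *
          ∫⁻ x in Set.Icc (-K₁) K₁, m ^ ((q - 1) * p) * (m * V) ^ (p - 1) * h x := by
        gcongr with x
        exact hpow x
    _ = ENNReal.ofReal (2 * K₁) ^ (q - 1) * (m ^ ((q - 1) * p) * (m * V) ^ (p - 1)) *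
          ∫⁻ z in cuboid d K₁ K₂, ‖g z‖ₑ := by
        rw [lintegral_const_mul _ hhm, lintegral_cuboid hgn, ← mul_assoc]
    _ = _ := by
        congr 1
        rw [hV, volume_cube d hK₂.le, hm, ← ENNReal.ofReal_mul hM.le,
          ENNReal.ofReal_rpow_of_pos (by positivity), ENNReal.ofReal_rpow_of_pos hM,
          ENNReal.ofReal_rpow_of_pos (by positivity), ← ENNReal.ofReal_mul (by positivity),
          ← ENNReal.ofReal_mul (by positivity)]
        congr 1
        rw [Real.mul_rpow hM.le (by positivity), ← Real.rpow_mul (by positivity),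
          show p * q - 1 = (q - 1) * p + (p - 1) by ring, Real.rpow_add hM]
        ring

end MixedSampling

/-! ### Reconstruction functions, the sampling law and the probability bound. -/

namespace MixedSampling

section Reconstruction

variable {𝓧 J ι κ : Type*} [Fintype J]

open Classical in
/-- Functions that recover the combinations of the functions `f j` from the samples, at the points
`x j k`, of the combinations of the functions `g j` with the same coefficients. -/
def reconstruction [Fintype ι] [Fintype κ] (g f : J → 𝓧 → ℂ) (x : ι → κ → 𝓧) (j : ι) (k : κ)
    (z : 𝓧) : ℂ :=
  if h : ∃ S : (ι × κ → ℂ) →ₗ[ℂ] (J → ℂ),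
      S.comp (LinearMap.pi fun i : ι × κ => evalAt g (x i.1 i.2)) = LinearMap.id then
    lincomb f (h.choose (Pi.single (j, k) 1)) z
  else 0

lemma lincomb_eq_sum_reconstruction [Fintype ι] [Fintype κ] {g : J → 𝓧 → ℂ} (f : J → 𝓧 → ℂ)
    {x : ι → κ → 𝓧} (hx : ∀ c : J → ℂ, (∀ j k, lincomb g c (x j k) = 0) → c = 0)
    (c : J → ℂ) (z : 𝓧) :
    lincomb f c z = ∑ j, ∑ k, lincomb g c (x j k) * reconstruction g f x j k z := by
  classical
  have h : ∃ S : (ι × κ → ℂ) →ₗ[ℂ] (J → ℂ),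
      S.comp (LinearMap.pi fun i : ι × κ => evalAt g (x i.1 i.2)) = LinearMap.id := by
    apply LinearMap.exists_leftInverse_of_injective
    rw [LinearMap.ker_eq_bot']
    exact fun c hc => hx c fun j k => congrFun hc (j, k)
  simp only [reconstruction, dif_pos h]
  set S := h.choose
  have hS := LinearMap.congr_fun h.choose_spec c
  simp only [LinearMap.comp_apply, LinearMap.id_apply] at hS
  -- The left inverse recovers `c` from its sample vector; expanding that vector in the standard
  -- basis gives the reconstruction formula.
  have h1 := LinearMap.pi_apply_eq_sum_univ ((evalAt f z).comp S)
    (LinearMap.pi (fun i : ι × κ => evalAt g (x i.1 i.2)) c)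
  rw [LinearMap.comp_apply, hS, evalAt_apply] at h1
  rw [h1, Fintype.sum_prod_type]
  refine Finset.sum_congr rfl fun j _ => Finset.sum_congr rfl fun k _ => ?_
  rw [LinearMap.pi_apply, evalAt_apply, smul_eq_mul, LinearMap.comp_apply, evalAt_apply]
  congr 3
  funext i
  simp [Pi.single_apply, eq_comm]

end Reconstruction

variable {d r N : ℕ}

/-- The indices of the coefficients of the members of `V_N`. -/
abbrev CoeffIdx (d r N : ℕ) : Type := Fin r × {k : Idx d // k ∈ box d N}

/-- The translates that span the finite sums `finSynth N F c`. -/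
def translates (N : ℕ) (F : Fin r → Dom d → ℂ) (j : CoeffIdx d r N) (z : Dom d) : ℂ :=
  F j.1 (z - latticePt j.2.1)

/-- Extension of a coefficient family by zero. -/
def extendCoeff (c : CoeffIdx d r N → ℂ) (i : Fin r) (k : Idx d) : ℂ :=
  if h : k ∈ box d N then c (i, ⟨k, h⟩) else 0

lemma extendCoeff_support (c : CoeffIdx d r N → ℂ) (i : Fin r) (k : Idx d) (hk : k ∉ box d N) :
    extendCoeff c i k = 0 := dif_neg hk

lemma extendCoeff_injective : Function.Injective (extendCoeff : (CoeffIdx d r N → ℂ) → _) := by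
  intro c c' h
  funext ⟨i, k, hk⟩
  have := congrFun (congrFun h i) k
  simpa [extendCoeff, hk] using this

lemma finSynth_eq_lincomb (F : Fin r → Dom d → ℂ) (c : Fin r → Idx d → ℂ) (z : Dom d) :
    finSynth N F c z = lincomb (translates N F) (fun j => c j.1 j.2.1) z := by
  simp only [finSynth, lincomb, translates]
  rw [Fintype.sum_prod_type, Finset.sum_comm]
  refine Finset.sum_congr rfl fun i _ => ?_
  exact (Finset.sum_coe_sort (box d N) fun k => c i k * F i (z - latticePt k)).symm

lemma lincomb_translates (F : Fin r → Dom d → ℂ) (c : CoeffIdx d r N → ℂ) (z : Dom d) :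
    lincomb (translates N F) c z = finSynth N F (extendCoeff c) z := by
  rw [finSynth_eq_lincomb]
  congr 1
  funext ⟨i, k, hk⟩
  simp [extendCoeff, hk]

variable {p q : ℝ} {φ : Fin r → Dom d → ℂ} {α₁ α₂ ctil s₁ s₂ K₁ K₂ : ℝ} {ψ : Dom d → ℂ}

/-- The bound of `f * ψ` in terms of the coefficients of `f`. -/
lemma norm_finSynth_conv_le (hd : 0 < d) (hr : 0 < r) (hp : 1 < p) (hq : 1 < q)
    (hA₁ : GeneratorAssumption p q φ α₁ α₂ ctil s₁ s₂) (hA₂ : AveragingAssumption K₁ K₂ ψ)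
    {c : Fin r → Idx d → ℂ} (hc : ∀ i k, k ∉ box d N → c i k = 0) (z : Dom d) :
    ‖finSynth N (fun i => conv (φ i) ψ) c z‖ ≤
      α₂ * cStar d p q α₁ ctil s₁ s₂ * l1Norm K₁ K₂ ψ * (vecSeqNorm p q c).toReal := by
  have hp0 : 0 < p := by linarith
  have hq0 : 0 < q := by linarith
  rw [← conv_finSynth (fun i z => hA₁.norm_le i z) hA₁.continuous hA₂.integrable,
    ← hA₂.integral_norm_eq]
  refine (norm_conv_le (S := α₂ * cStar d p q α₁ ctil s₁ s₂ * (vecSeqNorm p q c).toReal)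
    (fun w => ?_) hA₂.integrable z).trans (le_of_eq (by ring))
  have h1 := hA₁.enorm_finSynth_le hd hp hq N c w
  have hv := vecSeqNorm_lt_top hp0 hq0 hc
  have hL : 0 ≤ ctil * latticeConst d p q s₁ s₂ :=
    (mul_pos hA₁.ctil_pos (latticeConst_pos hd hp hq hA₁.s₁_gt hA₁.s₂_gt)).le
  rw [← ENNReal.ofReal_toReal hv.ne, ← ENNReal.ofReal_mul hL, ← ofReal_norm,
    ENNReal.ofReal_le_ofReal_iff (by positivity)] at h1
  refine h1.trans (mul_le_mul_of_nonneg_right ?_ ENNReal.toReal_nonneg)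
  refine (mul_latticeConst_le_cStar hd hp hq hA₁).trans ?_
  exact mul_le_mul_of_nonneg_right (hA₁.α₁_le_α₂ hr hp0 hq0) (cStar_pos hd hp hq hA₁).le

/-- If `ψ` had norm 0, every `φ i * ψ` would vanish, against the lower bound for a nonzero sequence.
-/
lemma l1Norm_pos (hr : 0 < r) (hp : 1 < p) (hq : 1 < q)
    (hA₁ : GeneratorAssumption p q φ α₁ α₂ ctil s₁ s₂) (hA₂ : AveragingAssumption K₁ K₂ ψ)
    {β : ℝ} (hβ : 0 < β)
    (hlower : ∀ c : Fin r → Idx d → ℂ, (∀ i, ∀ k, k ∉ box d N → c i k = 0) →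
      ENNReal.ofReal β * vecSeqNorm p q c ≤
        mixedNormCuboid p q K₁ K₂ (finSynth N (fun i => conv (φ i) ψ) c)) :
    0 < l1Norm K₁ K₂ ψ := by
  have hp0 : 0 < p := by linarith
  have hq0 : 0 < q := by linarith
  by_contra hneg
  have hz : ∀ i z, conv (φ i) ψ z = 0 := fun i z => by
    have h1 := norm_conv_le (fun z => hA₁.norm_le i z) hA₂.integrable z
    rw [hA₂.integral_norm_eq] at h1
    have h2 : ctil * l1Norm K₁ K₂ ψ ≤ 0 :=
      mul_nonpos_of_nonneg_of_nonpos hA₁.ctil_pos.le (not_lt.1 hneg)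
    exact norm_le_zero_iff.1 (h1.trans h2)
  have h0 := hlower (deltaSeq d r) (deltaSeq_support N)
  have h1 : finSynth N (fun i => conv (φ i) ψ) (deltaSeq d r) = fun _ => 0 := by
    funext z; simp [finSynth, hz]
  have h2 : mixedNormCuboid p q K₁ K₂ (fun _ : Dom d => (0 : ℂ)) = 0 := by
    simp [mixedNormCuboid, mixedNormOn, hp0, hq0, div_pos hp0 hq0]
  rw [h1, h2, nonpos_iff_eq_zero, mul_eq_zero, ENNReal.ofReal_eq_zero] at h0
  rcases h0 with h | h
  · linarith
  · exact vecSeqNorm_deltaSeq_ne_zero hr hp0 hq0 h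

lemma lintegral_le_of_density {ρ : Dom d → ℝ} {Cρ₁ Cρ₂ : ℝ}
    (hA₃ : DensityAssumption K₁ K₂ ρ Cρ₁ Cρ₂) (F : Dom d → ℝ≥0∞) :
    ENNReal.ofReal Cρ₁ * ∫⁻ z in cuboid d K₁ K₂, F z ≤
      ∫⁻ z, F z ∂(volume.restrict (cuboid d K₁ K₂)).withDensity
        (fun z => ENNReal.ofReal (ρ z)) := by
  have h1 : (volume.restrict (cuboid d K₁ K₂)).withDensity (fun _ => ENNReal.ofReal Cρ₁) ≤
      (volume.restrict (cuboid d K₁ K₂)).withDensity (fun z => ENNReal.ofReal (ρ z)) := by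
    apply withDensity_mono
    filter_upwards [ae_restrict_mem (measurableSet_cuboid d K₁ K₂)] with z hz
    exact ENNReal.ofReal_le_ofReal (hA₃.bounds z hz).1
  rw [withDensity_const] at h1
  rw [← smul_eq_mul, ← lintegral_smul_measure]
  exact lintegral_mono' h1 le_rfl

/-- The factor `(2K₁)^{q-1} (2K₂)^{d(p-1)}`. -/
def sizeConst (d : ℕ) (p q K₁ K₂ : ℝ) : ℝ := (2 * K₁) ^ (q - 1) * (2 * K₂) ^ (d * (p - 1))

lemma sizeConst_pos (hK₁ : 0 < K₁) (hK₂ : 0 < K₂) : 0 < sizeConst d p q K₁ K₂ := by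
  unfold sizeConst; positivity

/-- The `L¹` norm, with respect to the sampling density, of a bounded function on the cuboid. -/
lemma le_integral_of_mixedNormCuboid (hK₁ : 0 < K₁) (hK₂ : 0 < K₂) (hp : 1 < p) (hq : 1 < q)
    {ρ : Dom d → ℝ} {Cρ₁ Cρ₂ : ℝ} (hA₃ : DensityAssumption K₁ K₂ ρ Cρ₁ Cρ₂)
    {μ : Measure (Dom d)} [IsProbabilityMeasure μ]
    (hμ : μ = (volume.restrict (cuboid d K₁ K₂)).withDensity (fun z => ENNReal.ofReal (ρ z)))
    {g : Dom d → ℂ} (hg : Measurable g) {M b : ℝ} (hM : 0 < M) (hb : 0 < b)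
    (hgM : ∀ z, ‖g z‖ ≤ M) (hgb : ENNReal.ofReal b ≤ mixedNormCuboid p q K₁ K₂ g) :
    Cρ₁ / sizeConst d p q K₁ K₂ * (b / M) ^ (p * q) * M ≤ ∫ z, ‖g z‖ ∂μ := by
  have hB := sizeConst_pos (d := d) (p := p) (q := q) hK₁ hK₂
  set B := sizeConst d p q K₁ K₂ with hBdef
  have hpq : 0 < p * q := by nlinarith
  have hint : Integrable g μ := Integrable.of_bound hg.aestronglyMeasurable M
    (Filter.Eventually.of_forall hgM)
  have h1 := mixedNormCuboid_rpow_le hK₁ hK₂ hp hq hg hM hgM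
  have h2 := lintegral_le_of_density hA₃ fun z => ‖g z‖ₑ
  rw [← hμ, ← ofReal_integral_norm_eq_lintegral_enorm hint] at h2
  have h3 : ENNReal.ofReal (Cρ₁ * b ^ (p * q)) ≤
      ENNReal.ofReal (B * M ^ (p * q - 1) * ∫ z, ‖g z‖ ∂μ) := by
    calc ENNReal.ofReal (Cρ₁ * b ^ (p * q))
        = ENNReal.ofReal Cρ₁ * ENNReal.ofReal b ^ (p * q) := by
          rw [ENNReal.ofReal_mul hA₃.lower_pos.le, ENNReal.ofReal_rpow_of_pos hb]
      _ ≤ ENNReal.ofReal Cρ₁ * (ENNReal.ofReal (B * M ^ (p * q - 1)) *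
            ∫⁻ z in cuboid d K₁ K₂, ‖g z‖ₑ) := by
          gcongr
          exact (ENNReal.rpow_le_rpow hgb hpq.le).trans h1
      _ = ENNReal.ofReal (B * M ^ (p * q - 1)) *
            (ENNReal.ofReal Cρ₁ * ∫⁻ z in cuboid d K₁ K₂, ‖g z‖ₑ) := by ring
      _ ≤ ENNReal.ofReal (B * M ^ (p * q - 1)) * ENNReal.ofReal (∫ z, ‖g z‖ ∂μ) := by gcongr
      _ = _ := by rw [← ENNReal.ofReal_mul (by positivity)]
  have hI : 0 ≤ ∫ z, ‖g z‖ ∂μ := integral_nonneg fun z => norm_nonneg _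
  rw [ENNReal.ofReal_le_ofReal_iff (by positivity)] at h3
  have hMp : M ^ (p * q) = M ^ (p * q - 1) * M := by
    rw [← Real.rpow_add_one hM.ne', sub_add_cancel]
  have hMpos : 0 < M ^ (p * q - 1) := by positivity
  rw [Real.div_rpow hb.le hM.le, hMp]
  have : Cρ₁ / B * (b ^ (p * q) / (M ^ (p * q - 1) * M)) * M =
      Cρ₁ * b ^ (p * q) / (B * M ^ (p * q - 1)) := by field_simp
  rw [this, div_le_iff₀ (by positivity)]
  linarith

/-- With `τ = γ B t` all powers of `B` cancel and the rate becomes `(3/4)(γt)² / (6 + γt)`; dropping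
`γt` below and using `γ < 1` gives exactly `t²/8`. -/
lemma rate₁_le (hK₁ : 0 < K₁) (hK₂ : 0 < K₂) {γ t : ℝ} (hγ : γ ∈ Set.Ioo (0 : ℝ) 1)
    (ht : 0 < t) : rate₁ d p q K₁ K₂ (γ * (sizeConst d p q K₁ K₂ * t)) ≤ t ^ 2 / 8 := by
  have hB := sizeConst_pos (d := d) (p := p) (q := q) hK₁ hK₂
  obtain ⟨h0, h1⟩ := hγ
  have hinv : (2 * K₁) ^ (1 - q) * (2 * K₂) ^ ((d : ℝ) * (1 - p)) =
      (sizeConst d p q K₁ K₂)⁻¹ := by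
    unfold sizeConst
    rw [mul_inv, ← Real.rpow_neg (by positivity), ← Real.rpow_neg (by positivity)]
    congr 2 <;> ring
  have hS : 6 * (2 * K₁) ^ (q - 1) * (2 * K₂) ^ ((d : ℝ) * (p - 1)) =
      6 * sizeConst d p q K₁ K₂ := by unfold sizeConst; ring
  unfold rate₁
  rw [hinv, hS]
  set B := sizeConst d p q K₁ K₂
  have h3 : (√3 : ℝ) ^ 2 = 3 := Real.sq_sqrt (by norm_num)
  have : B⁻¹ * (√3 / 2 * (γ * (B * t))) ^ 2 / (6 * B + γ * (B * t)) =
      3 / 4 * (γ * t) ^ 2 / (6 + γ * t) := by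
    rw [mul_pow, div_pow, h3]
    field_simp
    norm_num
  rw [this, div_le_div_iff₀ (by positivity) (by norm_num)]
  have h4 : (γ * t) ^ 2 ≤ t ^ 2 := by
    apply pow_le_pow_left₀ (by positivity); nlinarith
  have h5 : 0 ≤ t ^ 2 * (γ * t) := by positivity
  nlinarith

/-- The first term alone suffices: its prefactor is at least 2 and its rate at most `t²/8`. The
second is nonnegative, so subtracting it only lowers the claimed probability. -/
lemma probBound_le (hK₁ : 0 < K₁) (hK₂ : 0 < K₂) {γ t : ℝ} (hγ : γ ∈ Set.Ioo (0 : ℝ) 1)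
    (ht : 0 < t) {Cρ₁ β c Ψ : ℝ} (hc : 0 ≤ c)
    (hτ : tau p q γ Cρ₁ β α₂ c Ψ = γ * (sizeConst d p q K₁ K₂ * t)) (n m : ℕ) :
    probBound d r N n m p q K₁ K₂ γ Cρ₁ β α₂ c Ψ ≤
      1 - 2 * Real.exp (-((n * m : ℕ) * (t ^ 2 / 8))) := by
  unfold probBound
  have hA2 : 0 ≤ constA₂ d r N c := by unfold constA₂; positivity
  have hA1 : 2 ≤ constA₁ d r N c := by
    unfold constA₁
    have h1 : 0 ≤ Real.log (4 * c + 1) := Real.log_nonneg (by linarith)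
    have : 1 ≤ Real.exp ((r : ℝ) * (2 * (N : ℝ) + 1) ^ (d + 1) * Real.log (4 * c + 1)) :=
      Real.one_le_exp (by positivity)
    linarith
  have h2 : Real.exp (-((n * m : ℕ) * (t ^ 2 / 8))) ≤
      Real.exp (-((n : ℝ) * m * rate₁ d p q K₁ K₂ (tau p q γ Cρ₁ β α₂ c Ψ))) := by
    rw [hτ]
    push_cast
    gcongr
    exact rate₁_le hK₁ hK₂ hγ ht
  have h3 := mul_le_mul hA1 h2 (Real.exp_pos _).le (by linarith)
  have h4 := mul_nonneg hA2 (Real.exp_pos (-((n : ℝ) * m * rate₂ d p q K₁ K₂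
    (tau p q γ Cρ₁ β α₂ c Ψ) c))).le
  linarith

/-- The joint law of finitely many of the samples. -/
lemma IIDSamples.map_eq_pi {Ω : Type*} [MeasurableSpace Ω] {P : Measure Ω}
    [IsProbabilityMeasure P] {ρ : Dom d → ℝ} {X : ℕ → ℕ → Ω → Dom d}
    (hX : IIDSamples P K₁ K₂ ρ X) {ι : Type*} [Fintype ι] {e : ι → ℕ × ℕ}
    (he : Function.Injective e) :
    P.map (fun ω i => X (e i).1 (e i).2 ω) = Measure.pi fun _ : ι =>
      (volume.restrict (cuboid d K₁ K₂)).withDensity (fun z => ENNReal.ofReal (ρ z)) := by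
  have h := hX.indep.precomp he
  rw [iIndepFun_iff_map_fun_eq_pi_map fun i => (hX.measurable _ _).aemeasurable] at h
  refine h.trans ?_
  congr 1
  funext i
  exact hX.law _ _

end MixedSampling

end

theorem theorem4p1
    {d r N : ℕ} (hd : 0 < d) (hr : 0 < r) (hN : 0 < N)
    {p q : ℝ} (hp : 1 < p) (hq : 1 < q)
    {K₁ K₂ : ℝ} (hK₁ : 0 < K₁) (hK₂ : 0 < K₂)
    {φ : Fin r → MixedSampling.Dom d → ℂ} {α₁ α₂ ctil s₁ s₂ : ℝ}
    (hA₁ : MixedSampling.GeneratorAssumption p q φ α₁ α₂ ctil s₁ s₂)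
    {ψ : MixedSampling.Dom d → ℂ} (hA₂ : MixedSampling.AveragingAssumption K₁ K₂ ψ)
    {ρ : MixedSampling.Dom d → ℝ} {Cρ₁ Cρ₂ : ℝ}
    (hA₃ : MixedSampling.DensityAssumption K₁ K₂ ρ Cρ₁ Cρ₂)
    {Ω : Type*} [MeasurableSpace Ω] {P : MeasureTheory.Measure Ω}
    [MeasureTheory.IsProbabilityMeasure P]
    {X : ℕ → ℕ → Ω → MixedSampling.Dom d} (hX : MixedSampling.IIDSamples P K₁ K₂ ρ X)
    {β : ℝ} (hβ : 0 < β)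
    (hlower : ∀ c : Fin r → MixedSampling.Idx d → ℂ,
      (∀ i, ∀ k, k ∉ MixedSampling.box d N → c i k = 0) →
      ENNReal.ofReal β * MixedSampling.vecSeqNorm p q c ≤
        MixedSampling.mixedNormCuboid p q K₁ K₂
          (MixedSampling.finSynth N (fun i => MixedSampling.conv (φ i) ψ) c))
    {γ : ℝ} (hγ : γ ∈ Set.Ioo (0 : ℝ) 1) (n m : ℕ) :
    -- the reconstruction functions are determined by the sample points
    ∃ G : (Fin n → Fin m → MixedSampling.Dom d) →
        Fin n → Fin m → MixedSampling.Dom d → ℂ,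
      ∃ E : Set Ω, MeasurableSet E ∧
        MixedSampling.probBound d r N n m p q K₁ K₂ γ Cρ₁ β α₂
            (MixedSampling.cStar d p q α₁ ctil s₁ s₂) (MixedSampling.l1Norm K₁ K₂ ψ)
          ≤ P.real E ∧
        ∀ ω ∈ E, ∀ f ∈ MixedSampling.VN N φ, ∀ z : MixedSampling.Dom d,
          f z = ∑ j : Fin n, ∑ k : Fin m,
            MixedSampling.conv f ψ (X j k ω) * G (fun j k => X j k ω) j k z := by
  open MixedSampling in
  have hp0 : 0 < p := by linarith
  have hq0 : 0 < q := by linarith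
  set g : CoeffIdx d r N → Dom d → ℂ := translates N fun i => conv (φ i) ψ with hg
  set c₀ := cStar d p q α₁ ctil s₁ s₂ with hc₀
  have hc₀pos : 0 < c₀ := cStar_pos hd hp hq hA₁
  set Ψ := l1Norm K₁ K₂ ψ with hΨ
  have hΨpos : 0 < Ψ := l1Norm_pos hr hp hq hA₁ hA₂ hβ hlower
  have hα₂ := hA₁.α₂_pos
  set M := α₂ * c₀ * Ψ with hM
  have hMpos : 0 < M := by positivity
  set B := sizeConst d p q K₁ K₂ with hB
  have hBpos : 0 < B := sizeConst_pos hK₁ hK₂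
  have hρpos := hA₃.lower_pos
  -- The constant of the `L¹` lower bound, chosen so that `τ = γ B t`.
  set t := Cρ₁ / B * (β / M) ^ (p * q) with ht
  have htpos : 0 < t := by positivity
  set μ : Measure (Dom d) :=
    (volume.restrict (cuboid d K₁ K₂)).withDensity (fun z => ENNReal.ofReal (ρ z)) with hμ
  have hμprob : IsProbabilityMeasure μ := by
    rw [hμ, ← hX.law 0 0]
    exact Measure.isProbabilityMeasure_map (hX.measurable 0 0).aemeasurable
  set Nm : (CoeffIdx d r N → ℂ) → ℝ :=
    fun c => M * (vecSeqNorm p q (extendCoeff c)).toReal with hNm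
  have hgm : ∀ j, Measurable (g j) := fun j =>
    ((continuous_conv (fun z => hA₁.norm_le j.1 z) (hA₁.continuous j.1) hA₂.integrable).comp
      (continuous_id.sub continuous_const)).measurable
  have hfin : ∀ c : CoeffIdx d r N → ℂ, vecSeqNorm p q (extendCoeff c) < ∞ := fun c =>
    vecSeqNorm_lt_top hp0 hq0 (extendCoeff_support c)
  have hb : ∀ c z, ‖lincomb g c z‖ ≤ Nm c := fun c z => by
    rw [hg, lincomb_translates]
    exact norm_finSynth_conv_le hd hr hp hq hA₁ hA₂ (extendCoeff_support c) z
  have hpos : ∀ c, c ≠ 0 → 0 < Nm c := fun c hc => by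
    refine mul_pos hMpos (ENNReal.toReal_pos (fun h => hc ?_) (hfin c).ne)
    apply extendCoeff_injective
    rw [eq_zero_of_vecSeqNorm_eq_zero hp0 hq0 h]
    funext i k; simp [extendCoeff]
  have hl : ∀ c, t * Nm c ≤ ∫ z, ‖lincomb g c z‖ ∂μ := fun c => by
    -- The norm comparison divides by the supremum bound, so the zero family is treated apart.
    by_cases hc : c = 0
    · have : extendCoeff (0 : CoeffIdx d r N → ℂ) = 0 := by funext i k; simp [extendCoeff]
      have h0 : Nm 0 = 0 := by
        simp [hNm, this, vecSeqNorm, seqNorm, hp0, hq0, div_pos hp0 hq0]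
      rw [hc, h0, mul_zero]
      exact integral_nonneg fun z => norm_nonneg _
    · have hN' := hpos c hc
      have hv : 0 < (vecSeqNorm p q (extendCoeff c)).toReal := pos_of_mul_pos_right hN' hMpos.le
      have h1 := le_integral_of_mixedNormCuboid hK₁ hK₂ hp hq hA₃ hμ (measurable_lincomb hgm c)
        hN' (mul_pos hβ hv) (hb c) (by
          have := hlower _ (extendCoeff_support c)
          rw [ENNReal.ofReal_mul hβ.le, ENNReal.ofReal_toReal (hfin c).ne]
          refine this.trans (le_of_eq ?_)
          congr 1; funext z
          rw [hg, lincomb_translates])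
      refine le_trans (le_of_eq ?_) h1
      rw [ht, hNm, mul_div_mul_right _ _ hv.ne']
  have hne : Nonempty (CoeffIdx d r N) := ⟨(⟨0, hr⟩, ⟨0, zero_mem_box d N⟩)⟩
  obtain ⟨-, hmain⟩ := pi_degenerateSamples_top_le hgm hb htpos hl hpos (n * m)
  -- The sequential argument needs the `n × m` array listed as one family; injectivity of the
  -- listing preserves independence.
  let e : Fin (n * m) → ℕ × ℕ := fun l =>
    (((finProdFinEquiv.symm l).1 : ℕ), ((finProdFinEquiv.symm l).2 : ℕ))
  have he : Function.Injective e := by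
    intro l l' h
    apply finProdFinEquiv.symm.injective
    exact Prod.ext (Fin.ext (congrArg Prod.fst h)) (Fin.ext (congrArg Prod.snd h))
  let Y : Ω → Fin (n * m) → Dom d := fun ω l => X (e l).1 (e l).2 ω
  have hY : Measurable Y := measurable_pi_lambda _ fun l => hX.measurable _ _
  set D := degenerateSamples g ⊤ (Fin (n * m)) with hD
  have hDm : MeasurableSet D := measurableSet_degenerateSamples hgm ⊤ _
  refine ⟨reconstruction g (translates N φ), Y ⁻¹' Dᶜ, hY hDm.compl, ?_, ?_⟩
  · have h1 : P.real (Y ⁻¹' D) ≤ 2 * Real.exp (-((n * m : ℕ) * (t ^ 2 / 8))) := by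
      rw [Measure.real, ← Measure.map_apply hY hDm, hX.map_eq_pi he]
      exact ENNReal.toReal_le_of_le_ofReal (by positivity) hmain
    have h2 : P.real (Y ⁻¹' Dᶜ) = 1 - P.real (Y ⁻¹' D) := by
      rw [Set.preimage_compl, probReal_compl_eq_one_sub (hY hDm)]
    rw [h2]
    refine (probBound_le hK₁ hK₂ hγ htpos hc₀pos.le ?_ n m).trans (by linarith)
    rw [tau, ← hB, ht, hM]
    have : β * (α₂ * c₀)⁻¹ / Ψ = β / (α₂ * c₀ * Ψ) := by field_simp
    rw [this]
    field_simp
  -- Outside the degenerate event the samples determine the coefficients, so one left inverse serves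
  -- every `f` at once.
  · rintro ω hω f ⟨c, rfl⟩ z
    rw [conv_finSynth (fun i z => hA₁.norm_le i z) hA₁.continuous hA₂.integrable]
    simp only [finSynth_eq_lincomb]
    refine lincomb_eq_sum_reconstruction _ (fun c' hc' => ?_) _ z
    by_contra hne'
    refine hω ⟨c', Submodule.mem_top, hne', fun l => ?_⟩
    exact hc' (finProdFinEquiv.symm l).1 (finProdFinEquiv.symm l).2
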